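/- Let $M$ be a (Hausdorff, second countable) smooth manifold of dimension $m\ge 1$ that is parallelizable, that is, $TM$ has a global smooth frame, and let $\Pi$ be a smooth $m$-vector field on $M$; zeros of $\Pi$ are allowed, so nowhere-vanishing $\Pi$ are included. For $\alpha\in\Omega^{m-1}(M)$ let $\Pi^\sharp\alpha=\iota_\alpha\Pi$ be the vector field given on decomposables by $\iota_\alpha(X_1\wedge\dots\wedge X_m)=\sum_{i}(-1)^{m-i}\alpha(X_1,\dots,\widehat{X_i},\dots,X_m)\,X_i$. For $k$-forms $\omega$ let $\iota_\omega$ denote the full contraction with $k$-vector fields, $\iota_\omega(X_1\wedge\dots\wedge X_k)=\omega(X_1,\dots,X_k)$. Then the bracket $$[\alpha,\beta]=\mathcal L_{\Pi^\sharp\alpha}\beta+(-1)^m(\iota_{d\alpha}\Pi)\,\beta,\qquad \alpha,\beta\in\Omega^{m-1}(M),$$ and the anchor $\rho=\Pi^\sharp$ make $\mathcal A=\wedge^{m-1}T^*M$ a Lie algebroid. Let $H^1(\mathcal A)$ be its first Lie algebroid cohomology with trivial coefficients. (a) For every volume form (nowhere-vanishing $m$-form) $\mu$ on $M$ there is an $(m-1)$-vector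 field $M^\mu$ with $$(\iota_\alpha M^\mu)\,\mu=\mathcal L_{\Pi^\sharp\alpha}\mu+(-1)^m(\iota_{d\alpha}\Pi)\,\mu\qquad\text{for all }\alpha\in\Omega^{m-1}(M),$$ the map $\alpha\mapsto\iota_\alpha M^\mu$ is a $1$-cocycle of $\mathcal A$, and its class in $H^1(\mathcal A)$ does not depend on $\mu$. Volume forms exist, so this defines a class $\operatorname{mod}(M,\Pi)\in H^1(\mathcal A)$, the modular class of the Nambu–Poisson manifold $(M,\Pi)$. (b) Let $Q_{\mathcal A}=\wedge^{m}\mathcal A\otimes\wedge^{m}T^*M$ be the canonical line bundle of $\mathcal A$, which is trivial, with the representation $\nabla_\alpha(X\otimes\nu)=[\alpha,X]\otimes\nu+X\otimes\mathcal L_{\rho(\alpha)}\nu$ of $\mathcal A$, where $[\alpha,\cdot\,]$ is extended to $\Gamma(\wedge^m\mathcal A)$ by $[\alpha,\beta_1\wedge\dots\wedge\beta_m]=\sum_i\beta_1\wedge\dots\wedge[\alpha,\beta_i]\wedge\dots\wedge\beta_m$. For every nowhere-vanishing section $s$ of $Q_{\mathcal A}$, the formula $\nabla_\alpha s=\theta_s(\alpha)\,s$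 defines a $1$-cocycle $\theta_s$ of $\mathcal A$, whose class in $H^1(\mathcal A)$ does not depend on $s$. This class $\operatorname{mod}(\mathcal A)\in H^1(\mathcal A)$ is the Evens–Lu–Weinstein modular class of $\mathcal A$. (c) In $H^1(\mathcal A)$, $$\operatorname{mod}(\mathcal A)=m\cdot\operatorname{mod}(M,\Pi).$$ -/

import Mathlib

open scoped TensorProduct Manifold ContDiff Bundle

namespace NambuModular

section SlotSum

variable {R L N : Type*} [CommRing R] [AddCommGroup L] [Module R L] [AddCommGroup N] [Module R N]
  {k : ℕ}

/-- `∑ᵢ f(v₁, …, T vᵢ, …, v_k)`. -/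
def slotSum (f : L [⋀^Fin k]→ₗ[R] N) (T : L → L) (v : Fin k → L) : N :=
  ∑ i, f (Function.update v i (T (v i)))

theorem slotSum_update_add (f : L [⋀^Fin k]→ₗ[R] N) (T : L → L)
    (hT : ∀ x y, T (x + y) = T x + T y) (v : Fin k → L) (i : Fin k) (x y : L) :
    slotSum f T (Function.update v i (x + y)) =
      slotSum f T (Function.update v i x) + slotSum f T (Function.update v i y) := by
  unfold slotSum
  rw [← Finset.sum_add_distrib]
  refine Finset.sum_congr rfl fun j _ => ?_
  rcases eq_or_ne j i with rfl | h
  · simp [hT, f.map_update_add]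
  · rw [Function.update_of_ne h, Function.update_of_ne h, Function.update_of_ne h,
      Function.update_comm h.symm, Function.update_comm h.symm, Function.update_comm h.symm,
      f.map_update_add]

theorem slotSum_update_smul (f : L [⋀^Fin k]→ₗ[R] N) (T : L → L) (δ : R → R)
    (hT : ∀ (r : R) x, T (r • x) = r • T x + δ r • x) (v : Fin k → L) (i : Fin k) (r : R) (x : L) :
    slotSum f T (Function.update v i (r • x)) =
      r • slotSum f T (Function.update v i x) + δ r • f (Function.update v i x) := by
  unfold slotSum
  have key : ∀ j, f (Function.update (Function.update v i (r • x)) j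
        (T (Function.update v i (r • x) j))) =
      r • f (Function.update (Function.update v i x) j (T (Function.update v i x j))) +
        if j = i then δ r • f (Function.update v i x) else 0 := by
    intro j
    rcases eq_or_ne j i with rfl | h
    · simp [hT, f.map_update_add, f.map_update_smul]
    · rw [Function.update_of_ne h, Function.update_of_ne h, Function.update_comm h.symm,
        Function.update_comm h.symm, f.map_update_smul, if_neg h, add_zero]
  simp only [key, Finset.sum_add_distrib, Finset.smul_sum, Finset.sum_ite_eq', Finset.mem_univ,
    if_true]

theorem slotSum_eq_zero_of_eq (f : L [⋀^Fin k]→ₗ[R] N) (T : L → L) (v : Fin k → L) (i j : Fin k)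
    (h : v i = v j) (hij : i ≠ j) : slotSum f T v = 0 := by
  unfold slotSum
  rw [Fintype.sum_eq_add i j hij]
  · have : Function.update v j (T (v j)) = Function.update v i (T (v i)) ∘ Equiv.swap i j := by
      funext l
      rcases eq_or_ne l i with rfl | hi
      · simp [Function.update_of_ne hij, Function.update_of_ne hij.symm, h]
      rcases eq_or_ne l j with rfl | hj
      · simp [h]
      · simp [Equiv.swap_apply_of_ne_of_ne hi hj, Function.update_of_ne hi, Function.update_of_ne hj]
    rw [this, f.map_swap _ hij, add_neg_cancel]
  · rintro l ⟨hi, hj⟩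
    exact f.map_eq_zero_of_eq _ (by simpa [Function.update_of_ne hi.symm, Function.update_of_ne hj.symm] using h) hij

end SlotSum

/-- A skew-symmetric bracket on an `R`-module `L` (a module of sections) together with an anchor,
given by its action on `R` (the functions), subject to the Leibniz rule. This is the part of a Lie
algebroid that enters the formulas for the Cartan calculus; the Jacobi identity and the
compatibility of the anchor with the brackets are added in `LieAlgebroid`. -/
structure SkewAlgebroid (R L : Type*) [CommRing R] [Algebra ℝ R] [AddCommGroup L] [Module R L] where
  /-- the bracket of sections -/
  bracket : L → L → L
  /-- the anchor, through its action on functions -/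
  act : L →ₗ[R] Derivation ℝ R R
  bracket_add : ∀ X Y Z, bracket X (Y + Z) = bracket X Y + bracket X Z
  bracket_swap : ∀ X Y, bracket X Y = -bracket Y X
  bracket_smul : ∀ X (f : R) Y, bracket X (f • Y) = f • bracket X Y + act X f • Y

/-- `k`-forms on the module of sections `L` over the ring of functions `R`: alternating `R`-multilinear
maps `L × ⋯ × L → R`. For `L = Γ(A)`, `R = C^∞(M)` this is `Γ(⋀^k A^*)`. -/
abbrev Form (R L : Type*) [CommRing R] [AddCommGroup L] [Module R L] (k : ℕ) : Type _ :=
  L [⋀^Fin k]→ₗ[R] R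

namespace SkewAlgebroid

variable {R L : Type*} [CommRing R] [Algebra ℝ R] [AddCommGroup L] [Module R L]
  (A : SkewAlgebroid R L)

theorem add_bracket (X Y Z : L) : A.bracket (X + Y) Z = A.bracket X Z + A.bracket Y Z := by
  rw [A.bracket_swap, A.bracket_add, neg_add, ← A.bracket_swap, ← A.bracket_swap]

theorem smul_bracket (f : R) (X Y : L) :
    A.bracket (f • X) Y = f • A.bracket X Y - A.act Y f • X := by
  rw [A.bracket_swap, A.bracket_smul, A.bracket_swap Y X]
  simp only [smul_neg, neg_add_rev, neg_neg]
  abel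

/-- The Lie derivative of a form,
`(𝓛_X α)(X₁, …, X_k) = ρ(X)(α(X₁, …, X_k)) - ∑ᵢ α(X₁, …, [X, Xᵢ], …, X_k)`. -/
def lieForm {k : ℕ} (X : L) (α : Form R L k) : Form R L k where
  toFun v := A.act X (α v) - slotSum α (A.bracket X) v
  map_update_add' v i x y := by
    rename_i inst
    obtain rfl : inst = instDecidableEqFin k := Subsingleton.elim _ _
    rw [slotSum_update_add α _ (A.bracket_add X), α.map_update_add, map_add]
    abel
  map_update_smul' v i r x := by
    rename_i inst
    obtain rfl : inst = instDecidableEqFin k := Subsingleton.elim _ _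
    rw [slotSum_update_smul α _ (fun r => A.act X r) (A.bracket_smul X), α.map_update_smul]
    simp only [smul_eq_mul, Derivation.leibniz]
    ring
  map_eq_zero_of_eq' v i j h hij := by
    rw [slotSum_eq_zero_of_eq α _ v i j h hij, α.map_eq_zero_of_eq v h hij, map_zero, sub_zero]

/-- `∑_{p < q} (-1)^{p+q} α([X_p, X_q], X₀, …, X̂_p, …, X̂_q, …, X_k)`; the pair `(i, j)` with `i ≤ j`
stands for `p = i`, `q = j + 1`. -/
def koszulBracketSum : {k : ℕ} → Form R L k → (Fin (k + 1) → L) → R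
  | 0, _, _ => 0
  | k + 1, α, X => ∑ i : Fin (k + 1), ∑ j ≥ i, (-1 : R) ^ (i + j + 1 : ℕ) *
      α (Matrix.vecCons (A.bracket (X i.castSucc) (X j.succ))
        (j.removeNth (i.castSucc.removeNth X)))

/-- The right-hand side of the formula for the differential of a `k`-form:
`∑ᵢ (-1)^i ρ(Xᵢ)(α(X₀, …, X̂ᵢ, …, X_k)) + ∑_{i < j} (-1)^{i+j} α([Xᵢ, Xⱼ], X₀, …, X̂ᵢ, …, X̂ⱼ, …, X_k)`. -/
def koszul {k : ℕ} (α : Form R L k) (X : Fin (k + 1) → L) : R :=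
  ∑ i : Fin (k + 1), (-1 : R) ^ (i : ℕ) * A.act (X i) (α (i.removeNth X)) + A.koszulBracketSum α X

/-- A form, regarded as an alternating `ℤ`-multilinear map. -/
def intForm {k : ℕ} (α : Form R L k) : L [⋀^Fin k]→ₗ[ℤ] R :=
  { α.toMultilinearMap.restrictScalars ℤ with map_eq_zero_of_eq' := α.map_eq_zero_of_eq' }

theorem exists_int_koszul {k : ℕ} (α : Form R L k) :
    ∃ g : L [⋀^Fin (k + 1)]→ₗ[ℤ] R, ∀ v, g v = A.koszul α v := by
  let f : L →ₗ[ℤ] L [⋀^Fin k]→ₗ[ℤ] R := AddMonoidHom.toIntLinearMap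
    { toFun := fun X => ((A.act X : R →ₗ[ℝ] R).toAddMonoidHom.toIntLinearMap).compAlternatingMap
        (intForm α)
      map_zero' := by ext; simp
      map_add' := by intro x y; ext; simp }
  have hf : ∀ X v, f X v = A.act X (α v) := fun _ _ => rfl
  have h1 : ∀ v, AlternatingMap.alternatizeUncurryFin f v =
      ∑ i : Fin (k + 1), (-1 : R) ^ (i : ℕ) * A.act (v i) (α (i.removeNth v)) := by
    intro v
    rw [AlternatingMap.alternatizeUncurryFin_apply]
    refine Finset.sum_congr rfl fun i _ => ?_
    rw [hf]
    rcases neg_one_pow_eq_or ℤ (i : ℕ) with h | h <;> rcases Nat.even_or_odd (i : ℕ) with e | e <;>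
      simp [e.neg_one_pow]
  cases k with
  | zero => exact ⟨AlternatingMap.alternatizeUncurryFin f, fun v => by simp [h1, koszul, koszulBracketSum]⟩
  | succ k =>
    let b : L →ₗ[ℤ] L →ₗ[ℤ] L := AddMonoidHom.toIntLinearMap
      { toFun := fun X => AddMonoidHom.toIntLinearMap
          (AddMonoidHom.mk' (A.bracket X) (A.bracket_add X))
        map_zero' := by
          ext Y
          have := A.add_bracket 0 0 Y
          simpa using this
        map_add' := by intro x y; ext z; exact A.add_bracket x y z }
    let g : L →ₗ[ℤ] L →ₗ[ℤ] L [⋀^Fin k]→ₗ[ℤ] R := LinearMap.compr₂ b (intForm α).curryLeft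
    refine ⟨AlternatingMap.alternatizeUncurryFin f + (-(1 / 2) : ℝ) •
      AlternatingMap.alternatizeUncurryFin (AlternatingMap.alternatizeUncurryFinLM ∘ₗ g), fun v => ?_⟩
    have hg : ∀ X Y w, g X Y w = α (Matrix.vecCons (A.bracket X Y) w) := fun _ _ _ => rfl
    rw [AlternatingMap.add_apply, AlternatingMap.smul_apply, h1, koszul, koszulBracketSum,
      AlternatingMap.alternatizeUncurryFin_alternatizeUncurryFinLM_comp_apply, Finset.smul_sum]
    congr 1
    refine Finset.sum_congr rfl fun i _ => ?_
    rw [Finset.smul_sum]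
    refine Finset.sum_congr rfl fun j _ => ?_
    rw [hg, hg, A.bracket_swap (v j.succ), ← neg_one_smul R (A.bracket _ _), α.map_vecCons_smul]
    generalize α _ = t
    rw [neg_one_smul, sub_neg_eq_add, ← two_smul ℝ t, pow_succ]
    rcases Nat.even_or_odd (i + j : ℕ) with e | e <;> simp [e.neg_one_pow, smul_smul]

theorem koszul_vecCons_smul {k : ℕ} (α : Form R L k) (r : R) (x : L) (v : Fin k → L) :
    A.koszul α (Matrix.vecCons (r • x) v) = r * A.koszul α (Matrix.vecCons x v) := by
  cases k with
  | zero => simp [koszul, koszulBracketSum]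
  | succ k =>
    have hrem : ∀ (p : Fin (k + 1)) (y : L), p.succ.removeNth (Matrix.vecCons y v) =
        Matrix.vecCons y (p.removeNth v) := by
      intro p y
      funext l
      refine Fin.cases ?_ (fun l => ?_) l <;> simp [Fin.removeNth]
    have h1 : ∀ y, ∑ i : Fin (k + 2), (-1 : R) ^ (i : ℕ) *
        A.act (Matrix.vecCons y v i) (α (i.removeNth (Matrix.vecCons y v))) =
        A.act y (α v) - ∑ j : Fin (k + 1), (-1 : R) ^ (j : ℕ) *
          A.act (v j) (α (Matrix.vecCons y (j.removeNth v))) := by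
      intro y
      rw [Fin.sum_univ_succ, sub_eq_add_neg, ← Finset.sum_neg_distrib]
      congr 1
      · simp
      · refine Finset.sum_congr rfl fun p _ => ?_
        rw [hrem]
        simp [pow_succ]
    have h2 : ∀ y, A.koszulBracketSum α (Matrix.vecCons y v) =
        - ∑ j : Fin (k + 1), (-1 : R) ^ (j : ℕ) *
          α (Matrix.vecCons (A.bracket y (v j)) (j.removeNth v)) +
        ∑ i : Fin k, ∑ j ≥ i.succ, (-1 : R) ^ (i.succ + j + 1 : ℕ) *
          α (Matrix.vecCons (A.bracket (v i.castSucc) (v j))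
            (j.removeNth (Matrix.vecCons y (i.castSucc.removeNth v)))) := by
      intro y
      rw [koszulBracketSum, Fin.sum_univ_succ, ← Finset.sum_neg_distrib]
      congr 1
      · have : (Finset.univ.filter fun j : Fin (k + 1) => 0 ≤ j) = Finset.univ := by ext; simp
        refine Finset.sum_congr (by ext; simp) fun p _ => ?_
        have : (Fin.castSucc (0 : Fin (k + 1))).removeNth (Matrix.vecCons y v) = v := by
          funext l; simp [Fin.removeNth]
        rw [this]
        simp [pow_succ]
      · refine Finset.sum_congr rfl fun p _ => Finset.sum_congr rfl fun j _ => ?_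
        rw [← Fin.succ_castSucc, hrem]
        simp
    have h3 : ∀ (i : Fin k) (j : Fin (k + 1)), j ≥ i.succ →
        α (Matrix.vecCons (A.bracket (v i.castSucc) (v j))
            (j.removeNth (Matrix.vecCons (r • x) (i.castSucc.removeNth v)))) =
        r * α (Matrix.vecCons (A.bracket (v i.castSucc) (v j))
            (j.removeNth (Matrix.vecCons x (i.castSucc.removeNth v)))) := by
      intro i j hj
      cases k with
      | zero => exact i.elim0
      | succ k =>
        obtain ⟨q, rfl⟩ := Fin.exists_succ_eq.mpr (show j ≠ 0 from fun h => by
          rw [h] at hj; exact absurd hj (by simp))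
        have hq : ∀ y, Matrix.vecCons (A.bracket (v i.castSucc) (v q.succ))
            (q.succ.removeNth (Matrix.vecCons y (i.castSucc.removeNth v))) =
            Function.update (Matrix.vecCons (A.bracket (v i.castSucc) (v q.succ))
            (q.succ.removeNth (Matrix.vecCons 0 (i.castSucc.removeNth v)))) 1 y := by
          intro y
          funext l
          refine Fin.cases ?_ (fun l => ?_) l
          · simp
          · refine Fin.cases ?_ (fun l => ?_) l
            · simp [Fin.removeNth]
            · rw [Function.update_of_ne (by simp [Fin.ext_iff])]
              simp [Fin.removeNth]
        rw [hq, α.map_update_smul, ← hq, smul_eq_mul]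
    rw [koszul, koszul, h1, h1, h2, h2]
    have h4 : ∑ i : Fin k, ∑ j ≥ i.succ, (-1 : R) ^ (i.succ + j + 1 : ℕ) *
          α (Matrix.vecCons (A.bracket (v i.castSucc) (v j))
            (j.removeNth (Matrix.vecCons (r • x) (i.castSucc.removeNth v)))) =
        r * ∑ i : Fin k, ∑ j ≥ i.succ, (-1 : R) ^ (i.succ + j + 1 : ℕ) *
          α (Matrix.vecCons (A.bracket (v i.castSucc) (v j))
            (j.removeNth (Matrix.vecCons x (i.castSucc.removeNth v)))) := by
      rw [Finset.mul_sum]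
      refine Finset.sum_congr rfl fun i _ => ?_
      rw [Finset.mul_sum]
      refine Finset.sum_congr rfl fun j hj => ?_
      rw [h3 i j (Finset.mem_Ici.mp hj)]
      ring
    have h5 : ∀ j, α (Matrix.vecCons (A.bracket (r • x) (v j)) (j.removeNth v)) =
        r * α (Matrix.vecCons (A.bracket x (v j)) (j.removeNth v)) -
          A.act (v j) r * α (Matrix.vecCons x (j.removeNth v)) := by
      intro j
      rw [A.smul_bracket, sub_eq_add_neg, α.map_vecCons_add, ← neg_smul, α.map_vecCons_smul,
        α.map_vecCons_smul]
      simp [sub_eq_add_neg]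
    have h6 : ∀ j, A.act (v j) (α (Matrix.vecCons (r • x) (j.removeNth v))) =
        r * A.act (v j) (α (Matrix.vecCons x (j.removeNth v))) +
          A.act (v j) r * α (Matrix.vecCons x (j.removeNth v)) := by
      intro j
      rw [α.map_vecCons_smul, smul_eq_mul, Derivation.leibniz]
      simp [mul_comm]
    rw [h4]
    simp only [h5, h6, mul_add, mul_sub, Finset.sum_add_distrib, Finset.sum_sub_distrib, map_smul,
      Derivation.smul_apply, smul_eq_mul, mul_neg, Finset.mul_sum, mul_left_comm r]
    ring

theorem koszul_update_smul {k : ℕ} (α : Form R L k) (v : Fin (k + 1) → L) (i : Fin (k + 1)) (r : R)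
    (x : L) : A.koszul α (Function.update v i (r • x)) = r • A.koszul α (Function.update v i x) := by
  obtain ⟨g, hg⟩ := A.exists_int_koszul α
  have h : ∀ y, Function.update v i y = i.insertNth y (i.removeNth v) := by
    intro y; simp
  rw [← hg, ← hg, h, h, g.map_insertNth, g.map_insertNth, hg, hg, koszul_vecCons_smul, smul_eq_mul,
    mul_smul_comm]

/-- The Lie algebroid differential `d_A`. -/
def d {k : ℕ} (α : Form R L k) : Form R L (k + 1) where
  toFun := A.koszul α
  map_update_add' v i x y := by
    rename_i inst
    obtain rfl : inst = instDecidableEqFin (k + 1) := Subsingleton.elim _ _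
    obtain ⟨g, hg⟩ := A.exists_int_koszul α
    rw [← hg, ← hg, ← hg, g.map_update_add]
  map_update_smul' v i r x := by
    rename_i inst
    obtain rfl : inst = instDecidableEqFin (k + 1) := Subsingleton.elim _ _
    exact A.koszul_update_smul α v i r x
  map_eq_zero_of_eq' v i j h hij := by
    obtain ⟨g, hg⟩ := A.exists_int_koszul α
    rw [← hg]
    exact g.map_eq_zero_of_eq v h hij

end SkewAlgebroid

section Multivectors

variable {R L : Type*} [CommRing R] [AddCommGroup L] [Module R L]

/-- The pairing of a `k`-form with a `k`-multisection, `ι_α(X₁ ∧ ⋯ ∧ X_k) = α(X₁, …, X_k)`; it is linear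
in the multisection. Sections of `⋀^k A` are represented by `⋀[R]^k L`. -/
noncomputable def pairing {k : ℕ} (α : Form R L k) : ⋀[R]^k L →ₗ[R] R :=
  exteriorPower.alternatingMapLinearEquiv α

/-- `ι_α(X₀ ∧ ⋯ ∧ X_n)` for an `n`-form `α`, see `sharpAlt_apply`. -/
def sharpAlt {n : ℕ} (α : Form R L n) : L [⋀^Fin (n + 1)]→ₗ[R] L :=
  (-1 : R) ^ n • AlternatingMap.alternatizeUncurryFin
    { toFun := fun X => α.smulRight X
      map_add' := by intro X Y; ext v; simp
      map_smul' := by intro r X; ext v; exact smul_comm _ _ _ }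

theorem sharpAlt_apply {n : ℕ} (α : Form R L n) (X : Fin (n + 1) → L) :
    sharpAlt α X = ∑ i : Fin (n + 1), ((-1 : R) ^ (n + i : ℕ) * α (i.removeNth X)) • X i := by
  rw [sharpAlt, AlternatingMap.smul_apply, AlternatingMap.alternatizeUncurryFin_apply,
    Finset.smul_sum]
  refine Finset.sum_congr rfl fun i _ => ?_
  rcases Nat.even_or_odd (i : ℕ) with e | e <;> simp [e.neg_one_pow, pow_add, smul_smul]

/-- For an `(n+1)`-multisection `P`, the map `P^♯ : Γ(⋀^n A^*) → Γ(A)`, `α ↦ ι_α P`. On decomposables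
`ι_α(X₀ ∧ ⋯ ∧ X_n) = ∑ᵢ (-1)^(n+i) α(X₀, …, X̂ᵢ, …, X_n) Xᵢ`, that is, `ι_α P = P(α ∧ ·)`. -/
noncomputable def sharp {n : ℕ} (P : ⋀[R]^(n + 1) L) : Form R L n →ₗ[R] L where
  toFun α := exteriorPower.alternatingMapLinearEquiv (sharpAlt α) P
  map_add' α β := by
    have : sharpAlt (α + β) = sharpAlt α + sharpAlt β := by
      ext X; simp [sharpAlt_apply, mul_add, add_smul, Finset.sum_add_distrib]
    rw [this, map_add, LinearMap.add_apply]
  map_smul' r α := by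
    have : sharpAlt (r • α) = r • sharpAlt α := by
      ext X
      simp only [sharpAlt_apply, AlternatingMap.smul_apply, Finset.smul_sum, smul_smul, smul_eq_mul]
      exact Finset.sum_congr rfl fun i _ => by ring_nf
    rw [this, map_smul, LinearMap.smul_apply, RingHom.id_apply]

/-- An `n`-multisection `N` of `A`, regarded as the `1`-cochain `α ↦ ι_α N` on `Γ(⋀^n A^*)`. -/
noncomputable def tensorCochain {n : ℕ} (N : ⋀[R]^n L) : Form R (Form R L n) 1 :=
  AlternatingMap.ofSubsingleton R (Form R L n) R (0 : Fin 1)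
    { toFun := fun α => pairing α N
      map_add' := fun α β => by simp [pairing]
      map_smul' := fun r α => by simp [pairing] }

theorem tensorCochain_apply {n : ℕ} (N : ⋀[R]^n L) (α : Form R L n) :
    tensorCochain N ![α] = pairing α N := rfl

end Multivectors

section Twist

variable {R N : Type*} [CommRing R] [Algebra ℝ R] [AddCommGroup N] [Module R N]

/-- `N × N` with the `R`-module structure `r • (p, q) = (r p, r q + δ(r) p)`. It serves to extend
first-order operators (which are not `R`-linear) to exterior powers. -/
def Twist (_δ : Derivation ℝ R R) (N : Type*) : Type _ := N × N

noncomputable instance (δ : Derivation ℝ R R) : AddCommGroup (Twist δ N) :=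
  inferInstanceAs (AddCommGroup (N × N))

noncomputable instance (δ : Derivation ℝ R R) : Module R (Twist δ N) where
  smul r p := ((r • p.1, r • p.2 + δ r • p.1) : N × N)
  one_smul p := Prod.ext (one_smul R p.1) (by
    change (1 : R) • p.2 + δ 1 • p.1 = p.2
    simp)
  mul_smul r s p := Prod.ext (mul_smul r s p.1) (by
    change (r * s) • p.2 + δ (r * s) • p.1 = r • (s • p.2 + δ s • p.1) + δ r • s • p.1
    rw [Derivation.leibniz]
    simp only [smul_eq_mul]
    module)
  smul_zero r := Prod.ext (smul_zero r) (by
    change r • (0 : N) + δ r • (0 : N) = 0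
    simp)
  smul_add r p q := Prod.ext (smul_add r p.1 q.1) (by
    change r • (p.2 + q.2) + δ r • (p.1 + q.1) = (r • p.2 + δ r • p.1) + (r • q.2 + δ r • q.1)
    module)
  add_smul r s p := Prod.ext (add_smul r s p.1) (by
    change (r + s) • p.2 + δ (r + s) • p.1 = (r • p.2 + δ r • p.1) + (s • p.2 + δ s • p.1)
    rw [map_add]
    module)
  zero_smul p := Prod.ext (zero_smul R p.1) (by
    change (0 : R) • p.2 + δ 0 • p.1 = 0
    simp)

theorem Twist.smul_def (δ : Derivation ℝ R R) (r : R) (p : Twist δ N) :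
    r • p = ((r • p.1, r • p.2 + δ r • p.1) : N × N) := rfl

end Twist

namespace SkewAlgebroid

variable {R L : Type*} [CommRing R] [Algebra ℝ R] [AddCommGroup L] [Module R L]
  (A : SkewAlgebroid R L)

/-- `(X₁, …, X_k) ↦ (X₁ ∧ ⋯ ∧ X_k, ∑ᵢ X₁ ∧ ⋯ ∧ [X, Xᵢ] ∧ ⋯ ∧ X_k)`. -/
noncomputable def lieMultiAlt (k : ℕ) (X : L) : L [⋀^Fin k]→ₗ[R] Twist (A.act X) (⋀[R]^k L) where
  toFun v := ((exteriorPower.ιMulti R k v, slotSum (exteriorPower.ιMulti R k) (A.bracket X) v) :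
    (⋀[R]^k L) × (⋀[R]^k L))
  map_update_add' v i x y := by
    rename_i inst
    obtain rfl : inst = instDecidableEqFin k := Subsingleton.elim _ _
    exact Prod.ext (AlternatingMap.map_update_add _ v i x y)
      (slotSum_update_add _ _ (A.bracket_add X) v i x y)
  map_update_smul' v i r x := by
    rename_i inst
    obtain rfl : inst = instDecidableEqFin k := Subsingleton.elim _ _
    exact Prod.ext (AlternatingMap.map_update_smul _ v i r x)
      (slotSum_update_smul _ _ (fun r => A.act X r) (A.bracket_smul X) v i r x)
  map_eq_zero_of_eq' v i j h hij :=
    Prod.ext (AlternatingMap.map_eq_zero_of_eq _ v h hij) (slotSum_eq_zero_of_eq _ _ v i j h hij)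

theorem lift_lieMultiAlt_fst (k : ℕ) (X : L) (P : ⋀[R]^k L) :
    (exteriorPower.alternatingMapLinearEquiv (A.lieMultiAlt k X) P).1 = P := by
  have hP : P ∈ (⊤ : Submodule R (⋀[R]^k L)) := trivial
  rw [← exteriorPower.ιMulti_span] at hP
  induction hP using Submodule.span_induction with
  | mem x hx =>
    obtain ⟨v, rfl⟩ := hx
    rw [exteriorPower.alternatingMapLinearEquiv_apply_ιMulti]
    rfl
  | zero => rw [map_zero]; rfl
  | add x y _ _ hx hy => rw [map_add]; exact congrArg₂ (· + ·) hx hy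
  | smul r x _ hx => rw [map_smul]; exact congrArg (r • ·) hx

/-- The Gerstenhaber bracket `[X, ·]` of a section with `k`-multisections. It is determined by
`[X, X₁ ∧ ⋯ ∧ X_k] = ∑ᵢ X₁ ∧ ⋯ ∧ [X, Xᵢ] ∧ ⋯ ∧ X_k`, see `lieMulti_ιMulti`. -/
noncomputable def lieMulti (k : ℕ) (X : L) : ⋀[R]^k L →+ ⋀[R]^k L where
  toFun P := (exteriorPower.alternatingMapLinearEquiv (A.lieMultiAlt k X) P).2
  map_zero' := by rw [map_zero]; rfl
  map_add' P Q := by rw [map_add]; rfl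

theorem lieMulti_ιMulti (k : ℕ) (X : L) (v : Fin k → L) :
    A.lieMulti k X (exteriorPower.ιMulti R k v) =
      ∑ i, exteriorPower.ιMulti R k (Function.update v i (A.bracket X (v i))) := by
  change (exteriorPower.alternatingMapLinearEquiv (A.lieMultiAlt k X) _).2 = _
  rw [exteriorPower.alternatingMapLinearEquiv_apply_ιMulti]
  rfl

theorem lieMulti_smul (k : ℕ) (X : L) (f : R) (P : ⋀[R]^k L) :
    A.lieMulti k X (f • P) = f • A.lieMulti k X P + A.act X f • P := by
  change (exteriorPower.alternatingMapLinearEquiv (A.lieMultiAlt k X) _).2 = _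
  rw [map_smul, Twist.smul_def, lift_lieMultiAlt_fst]
  rfl

theorem lieForm_smul {k : ℕ} (X : L) (f : R) (α : Form R L k) :
    A.lieForm X (f • α) = f • A.lieForm X α + A.act X f • α := by
  ext v
  change A.act X (f * α v) - slotSum (f • α) (A.bracket X) v =
    f * (A.act X (α v) - slotSum α (A.bracket X) v) + A.act X f * α v
  have : slotSum (f • α) (A.bracket X) v = f * slotSum α (A.bracket X) v := by
    simp [slotSum, Finset.mul_sum]
  rw [this, Derivation.leibniz]
  simp only [smul_eq_mul]
  ring

theorem lieForm_add {k : ℕ} (X : L) (α β : Form R L k) :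
    A.lieForm X (α + β) = A.lieForm X α + A.lieForm X β := by
  ext v
  change A.act X (α v + β v) - slotSum (α + β) (A.bracket X) v =
    (A.act X (α v) - slotSum α (A.bracket X) v) + (A.act X (β v) - slotSum β (A.bracket X) v)
  have : slotSum (α + β) (A.bracket X) v = slotSum α (A.bracket X) v + slotSum β (A.bracket X) v := by
    simp [slotSum, Finset.sum_add_distrib]
  rw [this, map_add]
  abel

theorem koszulBracketSum_add : ∀ {k : ℕ} (α β : Form R L k) (X : Fin (k + 1) → L),
    A.koszulBracketSum (α + β) X = A.koszulBracketSum α X + A.koszulBracketSum β X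
  | 0, _, _, _ => by simp [koszulBracketSum]
  | k + 1, α, β, X => by
    simp [koszulBracketSum, mul_add, Finset.sum_add_distrib]

theorem koszulBracketSum_smul : ∀ {k : ℕ} (c : ℝ) (α : Form R L k) (X : Fin (k + 1) → L),
    A.koszulBracketSum (c • α) X = c • A.koszulBracketSum α X
  | 0, _, _, _ => by simp [koszulBracketSum]
  | k + 1, c, α, X => by
    simp [koszulBracketSum, Finset.smul_sum]

/-- The differential as an `ℝ`-linear map. -/
def dLinear (k : ℕ) : Form R L k →ₗ[ℝ] Form R L (k + 1) where
  toFun := A.d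
  map_add' α β := by
    ext X
    change A.koszul (α + β) X = A.koszul α X + A.koszul β X
    simp only [koszul, koszulBracketSum_add, AlternatingMap.add_apply, map_add, mul_add,
      Finset.sum_add_distrib]
    ring
  map_smul' c α := by
    ext X
    change A.koszul (c • α) X = c • A.koszul α X
    simp only [koszul, koszulBracketSum_smul, AlternatingMap.smul_apply, Derivation.map_smul, smul_add,
      Finset.smul_sum, mul_smul_comm]

/-- The `k`-cocycles of the complex `(Γ(⋀^• A^*), d_A)`. -/
def closedForms (k : ℕ) : Submodule ℝ (Form R L k) := LinearMap.ker (A.dLinear k)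

/-- The `(k+1)`-coboundaries of the complex `(Γ(⋀^• A^*), d_A)`. -/
def exactForms (k : ℕ) : Submodule ℝ (Form R L (k + 1)) := LinearMap.range (A.dLinear k)

/-- The cohomology `H^{k+1}` with trivial coefficients: the image of the cocycles in the quotient of the
cochains by the coboundaries. -/
def cohomology (k : ℕ) : Submodule ℝ (Form R L (k + 1) ⧸ A.exactForms k) :=
  (A.closedForms (k + 1)).map (A.exactForms k).mkQ

/-- The cohomology class of a cocycle. -/
def cohomologyClass {k : ℕ} (θ : Form R L (k + 1)) (h : θ ∈ A.closedForms (k + 1)) : A.cohomology k :=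
  ⟨(A.exactForms k).mkQ θ, Submodule.mem_map_of_mem h⟩

/-- The bracket `[α, β] = 𝓛_{P^♯ α} β + (-1)^{n+1} (ι_{dα} P) β` on `Γ(⋀^n A^*)` attached to an
`(n+1)`-multisection `P` of `A`. -/
noncomputable def nambuBracket {n : ℕ} (P : ⋀[R]^(n + 1) L) (α β : Form R L n) : Form R L n :=
  A.lieForm (sharp P α) β + (-1 : R) ^ (n + 1) • pairing (A.d α) P • β

/-- `X ⊗ ν ↦ [a, X] ⊗ ν + X ⊗ 𝓛_b ν`, for sections `a`, `b` that act on functions in the same way. -/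
noncomputable def tensorLie {T : Type*} [AddCommGroup T] [Module R T] (B : SkewAlgebroid R T)
    (r k : ℕ) (a : L) (b : T) (h : A.act a = B.act b) :
    (⋀[R]^r L) ⊗[R] Form R T k →+ (⋀[R]^r L) ⊗[R] Form R T k :=
  TensorProduct.liftAddHom
    (AddMonoidHom.mk' (fun X => AddMonoidHom.mk' (fun ν => A.lieMulti r a X ⊗ₜ ν +
        X ⊗ₜ B.lieForm b ν)
      (fun ν ν' => by
        rw [SkewAlgebroid.lieForm_add, TensorProduct.tmul_add, TensorProduct.tmul_add]
        abel))
      (fun X X' => by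
        ext ν
        simp only [AddMonoidHom.mk'_apply, AddMonoidHom.add_apply, map_add, TensorProduct.add_tmul]
        abel))
    (fun f X ν => by
      simp only [AddMonoidHom.mk'_apply]
      rw [SkewAlgebroid.lieForm_smul, SkewAlgebroid.lieMulti_smul, TensorProduct.add_tmul,
        TensorProduct.tmul_add, TensorProduct.smul_tmul, TensorProduct.smul_tmul,
        TensorProduct.smul_tmul, h]
      abel)

theorem tensorLie_tmul {T : Type*} [AddCommGroup T] [Module R T] (B : SkewAlgebroid R T)
    (r k : ℕ) (a : L) (b : T) (h : A.act a = B.act b) (X : ⋀[R]^r L) (ν : Form R T k) :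
    A.tensorLie B r k a b h (X ⊗ₜ ν) = A.lieMulti r a X ⊗ₜ ν + X ⊗ₜ B.lieForm b ν := rfl

/-- `N` is the modular tensor field of `P` with respect to the top degree form `μ`:
`(ι_α N) μ = 𝓛_{P^♯ α} μ + (-1)^{n+1} (ι_{dα} P) μ` for all `α ∈ Γ(⋀^n A^*)`. -/
def IsModularTensor {n r : ℕ} (P : ⋀[R]^(n + 1) L) (μ : Form R L r) (N : ⋀[R]^n L) : Prop :=
  ∀ α : Form R L n, pairing α N • μ =
    A.lieForm (sharp P α) μ + (-1 : R) ^ (n + 1) • pairing (A.d α) P • μ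

end SkewAlgebroid

section Manifold

variable (m : ℕ) (M : Type*) [TopologicalSpace M] [ChartedSpace (EuclideanSpace ℝ (Fin m)) M]

/-- The ring `C^∞(M)` of smooth real functions on an `m`-manifold. -/
abbrev SmoothFun : Type _ := C^∞⟮𝓡 m, M; ℝ⟯

variable [IsManifold (𝓡 m) ∞ M]

/-- Smooth vector fields: smooth sections of the tangent bundle. -/
abbrev VField : Type _ :=
  Cₛ^∞⟮𝓡 m; EuclideanSpace ℝ (Fin m), (TangentSpace (𝓡 m) : M → Type _)⟯

variable {m M}

noncomputable instance : SMul (SmoothFun m M) (VField m M) where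
  smul f X := ⟨fun x => f x • X x, f.contMDiff.smul_section X.contMDiff⟩

theorem smul_vField_apply (f : SmoothFun m M) (X : VField m M) (x : M) : (f • X) x = f x • X x := rfl

noncomputable instance : Module (SmoothFun m M) (VField m M) where
  one_smul X := by ext x; simp [smul_vField_apply]
  mul_smul f g X := by ext x; simp [smul_vField_apply, mul_smul]
  smul_zero f := by ext x; simp [smul_vField_apply]
  smul_add f X Y := by ext x; simp [smul_vField_apply]
  add_smul f g X := by ext x; simp [smul_vField_apply, add_smul]
  zero_smul X := by ext x; simp [smul_vField_apply]

/-- The derivative `X f` of a function along a vector field. -/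
noncomputable def VField.apply (X : VField m M) (f : SmoothFun m M) : SmoothFun m M :=
  ⟨fun x => mvfderiv (𝓡 m) f x (X x), by
    have h1 : ContMDiff (𝓡 m).tangent 𝓘(ℝ, ℝ).tangent ∞ (tangentMap (𝓡 m) 𝓘(ℝ, ℝ) f) :=
      f.contMDiff.contMDiff_tangentMap (by simp)
    exact (contMDiff_snd_tangentBundle_modelSpace ℝ 𝓘(ℝ, ℝ)).comp (h1.comp X.contMDiff)⟩

theorem VField.apply_apply (X : VField m M) (f : SmoothFun m M) (x : M) :
    X.apply f x = mvfderiv (𝓡 m) f x (X x) := rfl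

/-- A vector field as a derivation of `C^∞(M)`. -/
noncomputable def VField.toDerivation : VField m M →ₗ[SmoothFun m M]
    Derivation ℝ (SmoothFun m M) (SmoothFun m M) where
  toFun X := Derivation.mk'
    { toFun := X.apply
      map_add' := fun f g => by
        ext x
        have := mvfderiv_add (I := 𝓡 m) (f.contMDiff.mdifferentiableAt (x := x) (by simp))
          (g.contMDiff.mdifferentiableAt (x := x) (by simp))
        exact congrArg (fun T => T (X x)) this
      map_smul' := fun c f => by
        ext x
        have := mvfderiv_smul (I := 𝓡 m) (mdifferentiableAt_const (c := c) (x := x))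
          (f.contMDiff.mdifferentiableAt (x := x) (by simp))
        have := congrArg (fun T => T (X x)) this
        rw [mvfderiv_const] at this
        simpa [VField.apply_apply] using! this }
    fun f g => by
      ext x
      have := mvfderiv_mul (I := 𝓡 m) (f.contMDiff.mdifferentiableAt (x := x) (by simp))
          (g.contMDiff.mdifferentiableAt (x := x) (by simp))
      have := congrArg (fun T => T (X x)) this
      simpa [VField.apply_apply] using! this
  map_add' X Y := by ext f x; simp [VField.apply_apply]
  map_smul' r X := by ext f x; simp [VField.apply_apply, smul_vField_apply]

theorem VField.toDerivation_apply (X : VField m M) (f : SmoothFun m M) :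
    VField.toDerivation X f = X.apply f := rfl

/-- The Lie bracket of vector fields. -/
noncomputable def VField.lie (X Y : VField m M) : VField m M :=
  ⟨VectorField.mlieBracket (𝓡 m) X Y, by
    have : IsManifold (𝓡 m) (((⊤ : ℕ∞) : WithTop ℕ∞) + 1) M := IsManifold.of_le (n := ∞) (by simp)
    have : IsManifold (𝓡 m) (minSmoothness ℝ 2) M := IsManifold.of_le (n := ∞) (by
      rw [minSmoothness_of_isRCLikeNormedField]; exact ENat.LEInfty.out)
    exact ContDiff.mlieBracket_vectorField (m := ⊤) (n := ⊤) X.contMDiff Y.contMDiff (by simp)⟩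

variable (m M) in
/-- A Lie algebroid over `M`, on the vector bundle with module of smooth sections `L`: a Lie bracket on
sections and a bundle map (a `C^∞(M)`-linear map on sections) to the tangent bundle. -/
structure LieAlgebroid (L : Type*) [AddCommGroup L] [Module (SmoothFun m M) L] where
  /-- the bracket of sections -/
  bracket : L → L → L
  /-- the anchor -/
  anchor : L →ₗ[SmoothFun m M] VField m M
  bracket_add : ∀ X Y Z, bracket X (Y + Z) = bracket X Y + bracket X Z
  bracket_swap : ∀ X Y, bracket X Y = -bracket Y X
  jacobi : ∀ X Y Z, bracket X (bracket Y Z) = bracket (bracket X Y) Z + bracket Y (bracket X Z)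
  bracket_smul : ∀ X (f : SmoothFun m M) Y,
    bracket X (f • Y) = f • bracket X Y + (anchor X).apply f • Y
  anchor_bracket : ∀ X Y, anchor (bracket X Y) = VField.lie (anchor X) (anchor Y)

variable (m M) in
/-- The tangent Lie algebroid. -/
noncomputable def tangentAlgebroid : LieAlgebroid m M (VField m M) where
  bracket := VField.lie
  anchor := LinearMap.id
  bracket_add X Y Z := by
    ext x
    exact VectorField.mlieBracket_add_right (Y.contMDiff.mdifferentiableAt (by simp))
      (Z.contMDiff.mdifferentiableAt (by simp))
  bracket_swap X Y := by
    ext x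
    exact VectorField.mlieBracket_swap_apply
  jacobi X Y Z := by
    ext x
    have : IsManifold (𝓡 m) (minSmoothness ℝ 3) M := IsManifold.of_le (n := ∞) (by
      rw [minSmoothness_of_isRCLikeNormedField]; exact ENat.LEInfty.out)
    have h : minSmoothness ℝ 2 ≤ ∞ := by
      rw [minSmoothness_of_isRCLikeNormedField]; exact ENat.LEInfty.out
    exact VectorField.leibniz_identity_mlieBracket_apply
      (X.contMDiff.contMDiffAt.of_le h) (Y.contMDiff.contMDiffAt.of_le h)
      (Z.contMDiff.contMDiffAt.of_le h)
  bracket_smul X f Y := by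
    ext x
    have := VectorField.mlieBracket_smul_right (I := 𝓡 m) (V := X) (W := Y)
      (f.contMDiff.mdifferentiableAt (x := x) (by simp))
      (Y.contMDiff.mdifferentiableAt (x := x) (by simp))
    rw [add_comm] at this
    exact this
  anchor_bracket X Y := rfl

variable (m M) in
/-- `M` is parallelizable: the tangent bundle has a global smooth frame. -/
def Parallelizable : Prop :=
  ∃ e : Fin m → (x : M) → TangentSpace (𝓡 m) x,
    IsLocalFrameOn (𝓡 m) (EuclideanSpace ℝ (Fin m)) ∞ e Set.univ

variable (m M) in
/-- A section `s` of a vector bundle with module of sections `Q` is nowhere vanishing. The fibre at `x`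
is `Q / 𝔪ₓ Q`, where `𝔪ₓ` is the ideal of the functions vanishing at `x`. -/
def NowhereVanishing {Q : Type*} [AddCommGroup Q] [Module (SmoothFun m M) Q] (s : Q) : Prop :=
  ∀ x : M, s ∉ RingHom.ker (ContMDiffMap.evalRingHom (I := 𝓡 m) (n := ∞) (R := ℝ)
    (I' := 𝓘(ℝ, ℝ)) x) • (⊤ : Submodule (SmoothFun m M) Q)

namespace LieAlgebroid

variable {L : Type*} [AddCommGroup L] [Module (SmoothFun m M) L] (A : LieAlgebroid m M L)

/-- The underlying skew algebroid, through which the Cartan calculus of `A` is defined. -/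
noncomputable def toSkew : SkewAlgebroid (SmoothFun m M) L where
  bracket := A.bracket
  act := VField.toDerivation ∘ₗ A.anchor
  bracket_add := A.bracket_add
  bracket_swap := A.bracket_swap
  bracket_smul := A.bracket_smul

/-- The first Lie algebroid cohomology of `A` with trivial coefficients. -/
noncomputable abbrev H1 : Type _ := A.toSkew.cohomology 0

/-- `c` is the characteristic class of the representation `D` of `A` on a trivial line bundle with module
of sections `Q`: every nowhere vanishing section `s` (there is one) defines, by `D_a s = θ(a) s`, a
`1`-cocycle `θ` of class `c`. -/
def IsCharacteristicClass {Q : Type*} [AddCommGroup Q] [Module (SmoothFun m M) Q]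
    (D : L → Q → Q) (c : A.H1) : Prop :=
  (∃ s : Q, NowhereVanishing m M s) ∧
    ∀ s : Q, NowhereVanishing m M s →
      ∃ (θ : Form (SmoothFun m M) L 1) (hθ : θ ∈ A.toSkew.closedForms 1),
        (∀ a, D a s = θ ![a] • s) ∧ A.toSkew.cohomologyClass θ hθ = c

/-- The sections of the line bundle `Q_A = ⋀^r A ⊗ ⋀^m T^*M`, where `r` is the rank of `A`. -/
abbrev CanonicalLine (_A : LieAlgebroid m M L) (r : ℕ) : Type _ :=
  (⋀[SmoothFun m M]^r L) ⊗[SmoothFun m M] Form (SmoothFun m M) (VField m M) m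

/-- The intrinsic representation of `A` on `Q_A`:
`∇_a (X ⊗ ν) = [a, X] ⊗ ν + X ⊗ 𝓛_{ρ(a)} ν`. -/
noncomputable def canonicalRep (r : ℕ) (a : L) : A.CanonicalLine r →+ A.CanonicalLine r :=
  A.toSkew.tensorLie (tangentAlgebroid m M).toSkew r m a (A.anchor a) rfl

theorem canonicalRep_tmul (r : ℕ) (a : L) (X : ⋀[SmoothFun m M]^r L)
    (ν : Form (SmoothFun m M) (VField m M) m) :
    A.canonicalRep r a (X ⊗ₜ ν) = A.toSkew.lieMulti r a X ⊗ₜ ν +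
      X ⊗ₜ (tangentAlgebroid m M).toSkew.lieForm (A.anchor a) ν :=
  A.toSkew.tensorLie_tmul _ _ _ _ _ _ _ _

/-- `c` is the Evens-Lu-Weinstein modular class of `A`, a Lie algebroid of rank `r` with trivial `Q_A`:
the characteristic class of the intrinsic representation on `Q_A`. -/
def IsModularClass (r : ℕ) (c : A.H1) : Prop :=
  A.IsCharacteristicClass (fun a s => A.canonicalRep r a s) c

end LieAlgebroid

section Nambu

variable {n : ℕ} (P : ⋀[SmoothFun m M]^(n + 1) (VField m M))
  (A : LieAlgebroid m M (Form (SmoothFun m M) (VField m M) n))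

/-- `A` is the Lie algebroid structure on `⋀^n T^*M` defined by the `(n+1)`-vector field `P`: its bracket
is `[α, β] = 𝓛_{P^♯ α} β + (-1)^{n+1} (ι_{dα} P) β`, its anchor is `P^♯`. -/
def IsNambuAlgebroid : Prop :=
  (∀ α β, A.bracket α β = (tangentAlgebroid m M).toSkew.nambuBracket P α β) ∧
    A.anchor = sharp P

/-- `c` is the modular class of `M` with the `(n+1)`-vector field `P`, as a class in the first Lie
algebroid cohomology of `A`, which is to be the Lie algebroid `⋀^n T^*M` defined by `P`: for every nowhere
vanishing top degree form `μ` (there is one), the modular tensor field `N` of `P` with respect to `μ`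
defines a `1`-cocycle `α ↦ ι_α N` of class `c`. -/
def IsNambuModularClass (c : A.H1) : Prop :=
  (∃ μ : Form (SmoothFun m M) (VField m M) m, NowhereVanishing m M μ) ∧
    ∀ μ : Form (SmoothFun m M) (VField m M) m, NowhereVanishing m M μ →
      ∃ (N : ⋀[SmoothFun m M]^n (VField m M))
        (hN : tensorCochain N ∈ A.toSkew.closedForms 1),
        (tangentAlgebroid m M).toSkew.IsModularTensor P μ N ∧
          A.toSkew.cohomologyClass (tensorCochain N) hN = c

end Nambu

end Manifold

end NambuModular

/-! A global frame `e` reduces everything to one function. Let `μ` be the volume form dual to `e`,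
and write `Π = f e₀ ∧ ⋯ ∧ eₙ` with `m = n + 1`; the function `f` may have zeros. The map `Z ↦ (-1)ⁿ
ι_Z μ` (`contractEquiv`) identifies vector fields with `n`-forms. Under it the anchor becomes `Z ↦ f
Z` (`sharp_smul_top_contractEquiv`), and the bracket becomes `f[Z,W] + Z(f) W - W(f) Z`
(`nambuBracket_contractEquiv`), which is formally `[fZ, fW] / f`. Since `f` may vanish one cannot
divide by it, so the Jacobi identity is checked by expansion (`scaledBracket_jacobi`).

Modular field: Cartan's formula and `dμ = 0` give `(-1)^(n+1) ι_{dα} Π = -f div Z`, while `𝓛_{fZ} μ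
= (f div Z + Z(f)) μ`. The divergences cancel, so the cocycle relative to `μ` is `Z ↦ Z(f)`
(`frameCocycle`).

Evens–Lu–Weinstein class: on the induced frame of `⋀^(n+1) A` the operator `[Z, ·]` acts by its
trace `n Z(f) - f div Z` (`lieMulti_frame`), and on `μ` the operator `𝓛_{fZ}` acts by `f div Z +
Z(f)`. The sum is `(n+1) Z(f)`, which is `m` times the cocycle above, already at the level of
cochains.

Independence of the choices is one argument for both classes
(`LieAlgebroid.isCharacteristicClass_iff`): replacing the generator of a trivial line bundle by `g`
times it, with `g` nowhere zero, adds the coboundary of `log |g|`. -/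

namespace NambuModular

/-! ### Alternating maps and exterior powers on a free module of rank `n + 1` -/

section FreeModule

variable {R L N : Type*} [CommRing R] [AddCommGroup L] [Module R L] [AddCommGroup N] [Module R N]
  {n : ℕ} (e : Module.Basis (Fin (n + 1)) R L)

/-- Both sides are alternating in `v`, so it suffices to compare them on injective families of basis
vectors; these are permutations of `e`, and both sides change by the sign. -/
theorem alternating_apply_eq_det_smul (f : L [⋀^Fin (n + 1)]→ₗ[R] N) (v : Fin (n + 1) → L) :
    f v = e.det v • f e := by
  have h : f = (LinearMap.toSpanSingleton R N (f e)).compAlternatingMap e.det := by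
    refine Module.Basis.ext_alternating e fun u hu => ?_
    let σ := Equiv.ofBijective u (Finite.injective_iff_bijective.mp hu)
    have hσ : (fun i => e (u i)) = fun i => e (σ i) := rfl
    rw [hσ]
    simp only [LinearMap.compAlternatingMap_apply, LinearMap.toSpanSingleton_apply]
    have h1 := f.map_perm (⇑e) σ
    have h2 := e.det.map_perm (⇑e) σ
    simp only [Function.comp_def] at h1 h2
    rw [h1, h2, e.det_self]
    rcases Int.units_eq_one_or (Equiv.Perm.sign σ) with hs | hs <;> simp [hs]
  exact DFunLike.congr_fun h v

theorem det_update_basis (j : Fin (n + 1)) (z : L) :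
    e.det (Function.update e j z) = e.repr z j := by
  have h : e.det.toMultilinearMap.toLinearMap e j = e.coord j := by
    refine e.ext fun k => ?_
    simp only [MultilinearMap.toLinearMap_apply, Module.Basis.coord_apply, Module.Basis.repr_self]
    -- For `k ≠ j` the vector `e k` sits in the two slots `j` and `k`, so the determinant vanishes.
    rcases eq_or_ne k j with rfl | hk
    · simp [e.det_self]
    · rw [Finsupp.single_eq_of_ne hk.symm]
      exact e.det.map_eq_zero_of_eq _ (i := j) (j := k) (by simp [Function.update_of_ne hk]) hk.symm
  exact LinearMap.congr_fun h z

theorem map_update_basis (f : L [⋀^Fin (n + 1)]→ₗ[R] N) (j : Fin (n + 1)) (z : L) :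
    f (Function.update e j z) = e.repr z j • f e := by
  rw [alternating_apply_eq_det_smul e, det_update_basis]

theorem det_vecCons_removeNth (i : Fin (n + 1)) (z : L) :
    e.det (Matrix.vecCons z (i.removeNth e)) = (-1 : R) ^ (i : ℕ) * e.repr z i := by
  have h : Function.update (⇑e) i z = i.insertNth z (i.removeNth e) := by simp
  have := e.det.map_insertNth i z (i.removeNth e)
  rw [← h, det_update_basis] at this
  rw [this]
  rcases Nat.even_or_odd (i : ℕ) with p | p <;> simp [p.neg_one_pow]

/-- An injection `Fin n → Fin (n + 1)` misses some index `i`, hence lists the frame without `e i` up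
to a permutation. -/
theorem alternating_ext_removeNth {α β : L [⋀^Fin n]→ₗ[R] N}
    (h : ∀ i : Fin (n + 1), α (i.removeNth e) = β (i.removeNth e)) : α = β := by
  refine Module.Basis.ext_alternating e fun u hu => ?_
  obtain ⟨i, hi⟩ : ∃ i, ∀ k, u k ≠ i := by
    by_contra! hc
    have := Fintype.card_le_of_surjective u hc
    simp at this
  choose w hw using fun k => Fin.exists_succAbove_eq (hi k)
  have hw' : Function.Injective w := fun a b hab => hu (by rw [← hw a, ← hw b, hab])
  let σ := Equiv.ofBijective w (Finite.injective_iff_bijective.mp hw')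
  have : (fun k => e (u k)) = fun k => i.removeNth e (σ k) := by
    funext k
    simp [σ, Fin.removeNth, hw]
  rw [this]
  have h1 := α.map_perm (i.removeNth e) σ
  have h2 := β.map_perm (i.removeNth e) σ
  simp only [Function.comp_def] at h1 h2
  rw [h1, h2, h i]

theorem form_eq_zero_of_rank_lt (e : Module.Basis (Fin (n + 1)) R L) (α : L [⋀^Fin (n + 2)]→ₗ[R] N) : α = 0 := by
  refine Module.Basis.ext_alternating e fun u hu => ?_
  have := Fintype.card_le_of_injective u hu
  simp at this

theorem neg_one_pow_mul_self (k : ℕ) : (-1 : R) ^ k * (-1) ^ k = 1 := by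
  rw [← mul_pow]; simp

/-- The isomorphism `Z ↦ (-1)ⁿ ι_Z μ` of vector fields with `n`-forms, where `μ` is the volume form
dual to the frame `e`. -/
noncomputable def contractEquiv : L ≃ₗ[R] Form R L n where
  toFun Z := (-1 : R) ^ n • e.det.curryLeft Z
  map_add' Z W := by simp
  map_smul' r Z := by
    ext v
    simp [mul_left_comm]
  -- The inverse is `α ↦ ι_α(e₀ ∧ ⋯ ∧ eₙ)`; the sign `(-1)ⁿ` in `toFun` is the one that makes this
  -- exact.
  invFun α := sharpAlt α e
  left_inv Z := by
    change sharpAlt _ e = Z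
    rw [sharpAlt_apply]
    conv_rhs => rw [← e.sum_repr Z]
    refine Finset.sum_congr rfl fun i _ => ?_
    congr 1
    simp only [AlternatingMap.smul_apply, AlternatingMap.curryLeft_apply_apply, smul_eq_mul,
      det_vecCons_removeNth, pow_add]
    linear_combination e.repr Z i * (-1) ^ (i : ℕ) * (-1) ^ (i : ℕ) * neg_one_pow_mul_self (R := R) n +
      e.repr Z i * neg_one_pow_mul_self (R := R) i
  right_inv α := by
    refine alternating_ext_removeNth e fun i => ?_
    have h : e.repr (sharpAlt α e) i = (-1 : R) ^ (n + i : ℕ) * α (i.removeNth e) := by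
      rw [sharpAlt_apply, e.repr_sum_self]
    change (-1 : R) ^ n * e.det (Matrix.vecCons (sharpAlt α e) (i.removeNth e)) = _
    rw [det_vecCons_removeNth, h, pow_add]
    linear_combination α (i.removeNth e) * (-1) ^ (i : ℕ) * (-1) ^ (i : ℕ) *
      neg_one_pow_mul_self (R := R) n + α (i.removeNth e) * neg_one_pow_mul_self (R := R) i

theorem contractEquiv_apply (Z : L) (v : Fin n → L) :
    contractEquiv e Z v = (-1 : R) ^ n * e.det (Matrix.vecCons Z v) := rfl

theorem contractEquiv_symm_apply (α : Form R L n) : (contractEquiv e).symm α = sharpAlt α e := rfl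

/-- The top exterior power of a free module is free of rank one. -/
noncomputable def topPowerEquiv : R ≃ₗ[R] ⋀[R]^(n + 1) L :=
  LinearEquiv.ofLinearMap (LinearMap.toSpanSingleton R _ (exteriorPower.ιMulti R (n + 1) e))
    (exteriorPower.alternatingMapLinearEquiv e.det)
    (by
      refine exteriorPower.linearMap_ext ?_
      ext1 v
      simp only [LinearMap.compAlternatingMap_apply, LinearMap.comp_apply,
        exteriorPower.alternatingMapLinearEquiv_apply_ιMulti, LinearMap.toSpanSingleton_apply,
        LinearMap.id_apply]
      exact (alternating_apply_eq_det_smul e _ v).symm)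
    (by
      refine LinearMap.ext_ring ?_
      simp [exteriorPower.alternatingMapLinearEquiv_apply_ιMulti, -exteriorPower.ιMulti_apply_coe,
        e.det_self])

theorem topPowerEquiv_apply (r : R) :
    topPowerEquiv e r = r • exteriorPower.ιMulti R (n + 1) e := rfl

/-- The top degree forms on a free module are free of rank one. -/
noncomputable def topFormEquiv : R ≃ₗ[R] Form R L (n + 1) :=
  LinearEquiv.ofLinearMap (LinearMap.toSpanSingleton R _ e.det)
    { toFun := fun α => α e, map_add' := fun _ _ => rfl, map_smul' := fun _ _ => rfl }
    (by
      ext α v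
      simp [alternating_apply_eq_det_smul e α v, mul_comm])
    (by
      refine LinearMap.ext_ring ?_
      simp [e.det_self])

theorem topFormEquiv_apply (r : R) : topFormEquiv e r = r • e.det := rfl

variable (f : R)

theorem pairing_smul_top (α : Form R L (n + 1)) :
    pairing α (f • exteriorPower.ιMulti R (n + 1) e) = f * α e := by
  rw [map_smul, pairing, exteriorPower.alternatingMapLinearEquiv_apply_ιMulti, smul_eq_mul]

/-- The inverse of `contractEquiv` is by construction the sharp map of `e₀ ∧ ⋯ ∧ eₙ`, so only the
factor `f` remains. -/
theorem sharp_smul_top_contractEquiv (Z : L) :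
    sharp (f • exteriorPower.ιMulti R (n + 1) e) (contractEquiv e Z) = f • Z := by
  change exteriorPower.alternatingMapLinearEquiv _ _ = _
  rw [map_smul, exteriorPower.alternatingMapLinearEquiv_apply_ιMulti, ← contractEquiv_symm_apply,
    LinearEquiv.symm_apply_apply]

/-- Every linear functional on `n`-forms comes from an `n`-multivector. This turns a `1`-cochain of
the Nambu algebroid into a modular tensor field. -/
theorem exists_pairing_eq (e : Module.Basis (Fin (n + 1)) R L) (l : Form R L n →ₗ[R] R) :
    ∃ N : ⋀[R]^n L, ∀ α : Form R L n, pairing α N = l α := by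
  -- Up to the sign `(-1)^(n+i)`, the multivectors `e₀ ∧ ⋯ êᵢ ⋯ ∧ eₙ` are dual to the forms
  -- `contractEquiv e (e i)`, so `N` is the expansion of `l` in that dual basis.
  refine ⟨∑ i : Fin (n + 1), ((-1 : R) ^ (n + i : ℕ) * l (contractEquiv e (e i))) •
    exteriorPower.ιMulti R n (i.removeNth e), fun α => ?_⟩
  obtain ⟨Z, rfl⟩ := (contractEquiv e).surjective α
  conv_rhs => rw [← e.sum_repr Z, map_sum, map_sum]
  rw [map_sum]
  refine Finset.sum_congr rfl fun i _ => ?_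
  rw [map_smul, map_smul, map_smul, pairing, exteriorPower.alternatingMapLinearEquiv_apply_ιMulti,
    contractEquiv_apply, det_vecCons_removeNth]
  simp only [smul_eq_mul, pow_add]
  linear_combination l (contractEquiv e (e i)) * e.repr Z i * (-1) ^ (i : ℕ) * (-1) ^ (i : ℕ) *
    neg_one_pow_mul_self (R := R) n +
      l (contractEquiv e (e i)) * e.repr Z i * neg_one_pow_mul_self (R := R) i

end FreeModule

/-! ### Cartan calculus and the bracket in a frame -/

namespace SkewAlgebroid

variable {R L : Type*} [CommRing R] [Algebra ℝ R] [AddCommGroup L] [Module R L]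
  (A : SkewAlgebroid R L)

theorem lieForm_apply {k : ℕ} (X : L) (α : Form R L k) (v : Fin k → L) :
    A.lieForm X α v = A.act X (α v) - ∑ i, α (Function.update v i (A.bracket X (v i))) := rfl

theorem d_apply {k : ℕ} (α : Form R L k) (v : Fin (k + 1) → L) : A.d α v = A.koszul α v := rfl

theorem bracket_sub (X Y Z : L) : A.bracket X (Y - Z) = A.bracket X Y - A.bracket X Z :=
  (AddMonoidHom.mk' (A.bracket X) (A.bracket_add X)).map_sub Y Z

/-- Apply the Jacobi identity to `X`, `Y`, `g • e i`: after the Leibniz rule and the Jacobi identity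
for `e i`, what remains is the claim times `e i`. Only one basis vector is needed, hence `Nonempty
ι`. -/
theorem act_bracket_of_jacobi {ι : Type*} [Nonempty ι] (e : Module.Basis ι R L)
    (hJ : ∀ X Y Z, A.bracket X (A.bracket Y Z) =
      A.bracket (A.bracket X Y) Z + A.bracket Y (A.bracket X Z)) (X Y : L) (g : R) :
    A.act (A.bracket X Y) g = A.act X (A.act Y g) - A.act Y (A.act X g) := by
  obtain ⟨i⟩ := ‹Nonempty ι›
  have h := hJ X Y (g • e i)
  simp only [bracket_smul, bracket_add] at h
  have h2 : A.act X (A.act Y g) • e i =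
      A.act (A.bracket X Y) g • e i + A.act Y (A.act X g) • e i := by
    have := hJ X Y (e i)
    rw [this] at h
    simp only [smul_add] at h
    rw [← sub_eq_zero] at h ⊢
    refine Eq.trans ?_ h
    module
  have h3 := congrArg (fun v => e.repr v i) h2
  simp only [map_add, map_smul, Finsupp.add_apply, Finsupp.smul_apply, Module.Basis.repr_self,
    Finsupp.single_eq_same, smul_eq_mul, mul_one] at h3
  rw [h3]; ring

/-- Cartan's formula `ι_Z d μ = 𝓛_Z μ - d ι_Z μ`. -/
theorem koszul_vecCons {k : ℕ} (μ : Form R L (k + 1)) (Z : L) (v : Fin (k + 1) → L) :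
    A.koszul μ (Matrix.vecCons Z v) = A.lieForm Z μ v - A.koszul (μ.curryLeft Z) v := by
  have hrem : ∀ p : Fin (k + 1), p.succ.removeNth (Matrix.vecCons Z v) =
      Matrix.vecCons Z (p.removeNth v) := by
    intro p
    funext l
    refine Fin.cases ?_ (fun l => ?_) l <;> simp [Fin.removeNth]
  have h1 : ∑ i : Fin (k + 2), (-1 : R) ^ (i : ℕ) *
      A.act (Matrix.vecCons Z v i) (μ (i.removeNth (Matrix.vecCons Z v))) =
      A.act Z (μ v) - ∑ j : Fin (k + 1), (-1 : R) ^ (j : ℕ) *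
        A.act (v j) (μ.curryLeft Z (j.removeNth v)) := by
    rw [Fin.sum_univ_succ, sub_eq_add_neg, ← Finset.sum_neg_distrib]
    congr 1
    · simp
    · refine Finset.sum_congr rfl fun p _ => ?_
      rw [hrem]
      simp [pow_succ]
  have h2 : A.koszulBracketSum μ (Matrix.vecCons Z v) =
      - ∑ j : Fin (k + 1), μ (Function.update v j (A.bracket Z (v j))) -
        A.koszulBracketSum (μ.curryLeft Z) v := by
    rw [koszulBracketSum, Fin.sum_univ_succ, ← Finset.sum_neg_distrib, sub_eq_add_neg]
    congr 1
    · refine Finset.sum_congr (by ext; simp) fun p _ => ?_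
      have h0 : (Fin.castSucc (0 : Fin (k + 1))).removeNth (Matrix.vecCons Z v) = v := by
        funext l; simp [Fin.removeNth]
      have hu : Function.update v p (A.bracket Z (v p)) =
          p.insertNth (A.bracket Z (v p)) (p.removeNth v) := by simp
      rw [h0, hu, μ.map_insertNth]
      rcases Nat.even_or_odd (p : ℕ) with q | q <;> simp [q.neg_one_pow, pow_succ]
    · cases k with
      | zero => simp [koszulBracketSum]
      | succ k =>
        rw [koszulBracketSum, ← Finset.sum_neg_distrib]
        refine Finset.sum_congr rfl fun i _ => ?_
        -- Pairs in which `Z` does not occur are the pairs of `v` with both indices shifted by one,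
        -- which leaves the sign unchanged.
        have hs : (Finset.Ici i.succ : Finset (Fin (k + 2))) =
            (Finset.Ici i).map (Fin.succEmb (k + 1)) := by
          ext j
          refine Fin.cases ?_ (fun j => ?_) j <;> simp
        rw [hs, Finset.sum_map, ← Finset.sum_neg_distrib]
        refine Finset.sum_congr rfl fun j _ => ?_
        have hc : ∀ Y, (j.succ).removeNth (i.succ.castSucc.removeNth (Matrix.vecCons Z Y)) =
            Matrix.vecCons Z (j.removeNth (i.castSucc.removeNth Y)) := by
          intro Y
          funext l
          rw [← Fin.succ_castSucc]
          refine Fin.cases ?_ (fun l => ?_) l <;> simp [Fin.removeNth]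
        -- In these terms the bracket precedes `Z`; moving `Z` to the first slot produces the minus
        -- sign before `d ι_Z μ`.
        have hsw : ∀ (X Y : L) (w : Fin k → L), μ (Matrix.vecCons X (Matrix.vecCons Y w)) =
            -μ (Matrix.vecCons Y (Matrix.vecCons X w)) := by
          intro X Y w
          have := μ.map_swap (Matrix.vecCons Y (Matrix.vecCons X w)) (i := 0) (j := 1) (by simp)
          rw [← this]
          congr 1
          funext l
          refine Fin.cases ?_ (fun l => Fin.cases ?_ (fun l => ?_) l) l
          · simp
          · simp
          · have h0 : l.succ.succ ≠ 0 := Fin.succ_ne_zero _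
            have h1 : l.succ.succ ≠ 1 := by simp [Fin.ext_iff]
            simp [Equiv.swap_apply_of_ne_of_ne h0 h1]
        simp only [Fin.coe_succEmb]
        rw [hc, hsw, ← Fin.succ_castSucc, AlternatingMap.curryLeft_apply_apply]
        simp only [Matrix.cons_val_succ, Fin.val_succ]
        ring
  rw [koszul, koszul, h1, h2, lieForm_apply]
  ring

/-- This is `𝓛_X ι_W = ι_{[X,W]} + ι_W 𝓛_X`: the first slot of `𝓛_X μ` contributes the term with
`[X, W]`. -/
theorem lieForm_curryLeft {k : ℕ} (μ : Form R L (k + 1)) (X W : L) :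
    A.lieForm X (μ.curryLeft W) = μ.curryLeft (A.bracket X W) + (A.lieForm X μ).curryLeft W := by
  ext v
  simp only [AlternatingMap.add_apply, AlternatingMap.curryLeft_apply_apply, lieForm_apply,
    Fin.sum_univ_succ, Matrix.cons_val_zero, Matrix.cons_val_succ]
  have h0 : Function.update (Matrix.vecCons W v) 0 (A.bracket X W) =
      Matrix.vecCons (A.bracket X W) v := by
    simp [Matrix.vecCons]
  have hs : ∀ i, Function.update (Matrix.vecCons W v) (Fin.succ i) (A.bracket X (v i)) =
      Matrix.vecCons W (Function.update v i (A.bracket X (v i))) := by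
    intro i
    simp [Matrix.vecCons, Fin.cons_update]
  rw [h0]
  simp only [hs]
  ring

theorem lieForm_smul_form {k : ℕ} (X : L) (c : ℝ) (α : Form R L k) :
    A.lieForm X (c • α) = c • A.lieForm X α := by
  ext v
  simp [lieForm_apply, smul_sub, Finset.smul_sum]

section Frame

variable {n : ℕ} (e : Module.Basis (Fin (n + 1)) R L)

/-- The divergence with respect to the volume form dual to a frame. -/
noncomputable def divergence (Z : L) : R := A.lieForm Z e.det e

theorem lieForm_det (Z : L) : A.lieForm Z e.det = A.divergence e Z • e.det := by
  ext v
  rw [alternating_apply_eq_det_smul e, AlternatingMap.smul_apply, smul_eq_mul, smul_eq_mul, mul_comm]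
  rfl

/-- The dual volume form is constant on the frame, so only the bracket terms survive, and they form
the trace of `[Z, ·]`. This links `div` to the action on the top power of the algebroid. -/
theorem divergence_eq (Z : L) : A.divergence e Z = -∑ j, e.repr (A.bracket Z (e j)) j := by
  rw [divergence, lieForm_apply, e.det_self]
  simp [det_update_basis]

theorem sum_act_repr (g : R) (Z : L) : ∑ j, A.act (e j) g * e.repr Z j = A.act Z g := by
  let l : L →ₗ[R] R := { toFun := fun Z => A.act Z g, map_add' := by simp, map_smul' := by simp }
  change _ = l Z
  conv_rhs => rw [← e.sum_repr Z, map_sum]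
  simp [l, mul_comm]

theorem divergence_smul (f : R) (Z : L) :
    A.divergence e (f • Z) = f * A.divergence e Z + A.act Z f := by
  rw [divergence_eq, divergence_eq, ← A.sum_act_repr e f Z]
  simp only [smul_bracket, map_sub, map_smul, Finsupp.sub_apply, Finsupp.smul_apply, smul_eq_mul,
    Finset.sum_sub_distrib, Finset.mul_sum, mul_neg]
  ring

theorem koszul_contractEquiv (Z : L) :
    A.koszul (contractEquiv e Z) e = (-1 : R) ^ n * A.divergence e Z := by
  -- The volume form is closed for degree reasons, so Cartan's formula gives `d ι_Z μ = 𝓛_Z μ`.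
  have h1 : A.koszul e.det (Matrix.vecCons Z e) = 0 := by
    rw [← d_apply, form_eq_zero_of_rank_lt e (A.d e.det)]; rfl
  rw [koszul_vecCons, sub_eq_zero] at h1
  -- The sign is rewritten as a real scalar because the differential is only `ℝ`-linear.
  have h2 : contractEquiv e Z = ((-1 : ℝ) ^ n) • e.det.curryLeft Z := by
    ext v
    rw [contractEquiv_apply]
    rcases Nat.even_or_odd n with p | p <;> simp [p.neg_one_pow]
  have h3 := (A.dLinear n).map_smul ((-1 : ℝ) ^ n) (e.det.curryLeft Z)
  have h4 : A.koszul (((-1 : ℝ) ^ n) • e.det.curryLeft Z) e =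
      ((-1 : ℝ) ^ n) • A.koszul (e.det.curryLeft Z) e := DFunLike.congr_fun h3 (⇑e)
  rw [h2, h4, ← h1, divergence]
  rcases Nat.even_or_odd n with p | p <;> simp [p.neg_one_pow]

variable (f : R)

theorem pairing_d_contractEquiv (Z : L) :
    (-1 : R) ^ (n + 1) * pairing (A.d (contractEquiv e Z)) (f • exteriorPower.ιMulti R (n + 1) e) =
      -(f * A.divergence e Z) := by
  rw [pairing_smul_top, d_apply, koszul_contractEquiv, pow_succ]
  linear_combination -f * A.divergence e Z * neg_one_pow_mul_self (R := R) n

theorem lieForm_contractEquiv (X W : L) : A.lieForm X (contractEquiv e W) =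
    contractEquiv e (A.bracket X W + A.divergence e X • W) := by
  have h : ∀ W, contractEquiv e W = ((-1 : ℝ) ^ n) • e.det.curryLeft W := by
    intro W
    ext v
    rw [contractEquiv_apply]
    rcases Nat.even_or_odd n with p | p <;> simp [p.neg_one_pow]
  rw [h, lieForm_smul_form, lieForm_curryLeft, lieForm_det, h]
  congr 1
  ext v
  simp

/-- The bracket on sections obtained from `[f X, f Y] / f`. -/
def scaledBracket (X Y : L) : L := f • A.bracket X Y + A.act X f • Y - A.act Y f • X

/-- `𝓛_{fZ}` contributes `[fZ, W] + div(fZ) W`, and the correction term contributes `-f div Z · W`.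
The divergence of `Z` cancels and leaves `Z(f) W`. -/
theorem nambuBracket_contractEquiv (Z W : L) :
    A.nambuBracket (f • exteriorPower.ιMulti R (n + 1) e) (contractEquiv e Z) (contractEquiv e W) =
      contractEquiv e (A.scaledBracket f Z W) := by
  rw [nambuBracket, sharp_smul_top_contractEquiv, lieForm_contractEquiv, smul_smul,
    pairing_d_contractEquiv, ← map_smul, ← map_add, divergence_smul, smul_bracket, scaledBracket]
  congr 1
  module

/-- Since `div(fZ) = f div Z + Z(f)` and the pairing term is `-f div Z`, only `Z(f)` survives; this
is the modular cocycle relative to the dual volume form. -/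
theorem lieForm_add_pairing_det (Z : L) :
    A.lieForm (sharp (f • exteriorPower.ιMulti R (n + 1) e) (contractEquiv e Z)) e.det +
      (-1 : R) ^ (n + 1) • pairing (A.d (contractEquiv e Z))
        (f • exteriorPower.ιMulti R (n + 1) e) • e.det = A.act Z f • e.det := by
  rw [smul_smul, pairing_d_contractEquiv, sharp_smul_top_contractEquiv, lieForm_det,
    divergence_smul]
  module

theorem scaledBracket_swap (X Y : L) : A.scaledBracket f X Y = -A.scaledBracket f Y X := by
  rw [scaledBracket, scaledBracket, A.bracket_swap X Y]
  module

theorem scaledBracket_add (X Y Z : L) :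
    A.scaledBracket f X (Y + Z) = A.scaledBracket f X Y + A.scaledBracket f X Z := by
  simp only [scaledBracket, bracket_add, map_add, Derivation.add_apply]
  module

theorem scaledBracket_smul (X : L) (g : R) (Y : L) :
    A.scaledBracket f X (g • Y) = g • A.scaledBracket f X Y + (f * A.act X g) • Y := by
  simp only [scaledBracket, bracket_smul, map_smul, Derivation.smul_apply, smul_eq_mul]
  module

theorem smul_scaledBracket (X Y : L) : f • A.scaledBracket f X Y = A.bracket (f • X) (f • Y) := by
  simp only [scaledBracket, bracket_smul, smul_bracket, map_smul, Derivation.smul_apply, smul_eq_mul]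
  module

/-- Multiplying by `f` would reduce this to the Jacobi identity for `fX`, `fY`, `fZ`, but `f` may
have zeros. So everything is expanded, using `hc` for the second-order terms in `f`. -/
theorem scaledBracket_jacobi
    (hJ : ∀ X Y Z, A.bracket X (A.bracket Y Z) =
      A.bracket (A.bracket X Y) Z + A.bracket Y (A.bracket X Z))
    (hc : ∀ X Y g, A.act (A.bracket X Y) g = A.act X (A.act Y g) - A.act Y (A.act X g))
    (X Y Z : L) :
    A.scaledBracket f X (A.scaledBracket f Y Z) =
      A.scaledBracket f (A.scaledBracket f X Y) Z + A.scaledBracket f Y (A.scaledBracket f X Z) := by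
  have hsub : ∀ X Y Z, A.bracket (X - Y) Z = A.bracket X Z - A.bracket Y Z := by
    intro X Y Z
    rw [A.bracket_swap, bracket_sub, A.bracket_swap X, A.bracket_swap Y]
    abel
  simp only [scaledBracket, bracket_add, bracket_sub, bracket_smul, add_bracket, smul_bracket, hsub,
    map_add, map_sub, map_smul, Derivation.add_apply, Derivation.sub_apply, Derivation.smul_apply, hc,
    smul_eq_mul, hJ X Y Z]
  rw [A.bracket_swap Y X]
  module

end Frame

end SkewAlgebroid

theorem form_one_ext {R L : Type*} [CommRing R] [AddCommGroup L] [Module R L] {θ θ' : Form R L 1}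
    (h : ∀ X, θ ![X] = θ' ![X]) : θ = θ' := by
  ext v
  have : v = ![v 0] := by ext i; fin_cases i; rfl
  rw [this, h]

/-! ### The canonical line bundle and degree-one cohomology -/

section FreeModule

variable {R L : Type*} [CommRing R] [AddCommGroup L] [Module R L]
  {n : ℕ} (e : Module.Basis (Fin (n + 1)) R L)

/-- The module of sections of the canonical line bundle of the Lie algebroid `⋀ⁿ T^*M` is free of
rank one. -/
noncomputable def canonicalLineEquiv :
    R ≃ₗ[R] (⋀[R]^(n + 1) (Form R L n)) ⊗[R] Form R L (n + 1) :=
  (TensorProduct.lid R R).symm.trans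
    (TensorProduct.congr (topPowerEquiv (e.map (contractEquiv e))) (topFormEquiv e))

theorem canonicalLineEquiv_apply (g : R) : canonicalLineEquiv e g =
    exteriorPower.ιMulti R (n + 1) (e.map (contractEquiv e)) ⊗ₜ (g • e.det) := by
  change topPowerEquiv _ 1 ⊗ₜ[R] topFormEquiv e g = _
  rw [topPowerEquiv_apply, one_smul, topFormEquiv_apply]

end FreeModule

namespace SkewAlgebroid

variable {R L : Type*} [CommRing R] [Algebra ℝ R] [AddCommGroup L] [Module R L]
  (A : SkewAlgebroid R L)

theorem koszul_one_form (θ : Form R L 1) (v : Fin 2 → L) :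
    A.koszul θ v = A.act (v 0) (θ ![v 1]) - A.act (v 1) (θ ![v 0]) -
      θ ![A.bracket (v 0) (v 1)] := by
  have h0 : (0 : Fin 2).removeNth v = ![v 1] := by ext i; fin_cases i; rfl
  have h1 : (1 : Fin 2).removeNth v = ![v 0] := by ext i; fin_cases i; rfl
  have h2 : ∀ w : Fin 0 → L, Matrix.vecCons (A.bracket (v 0) (v 1)) w =
      ![A.bracket (v 0) (v 1)] := by
    intro w; ext i; fin_cases i; rfl
  simp [koszul, koszulBracketSum, Fin.sum_univ_two, h0, h1, h2]
  ring

theorem mem_closedForms_one {θ : Form R L 1} :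
    θ ∈ A.closedForms 1 ↔ ∀ X Y, θ ![A.bracket X Y] = A.act X (θ ![Y]) - A.act Y (θ ![X]) := by
  have key : ∀ v : Fin 2 → L, A.dLinear 1 θ v = A.koszul θ v := fun _ => rfl
  rw [closedForms, LinearMap.mem_ker]
  constructor
  · intro h X Y
    have := key ![X, Y]
    rw [h, koszul_one_form] at this
    simp only [AlternatingMap.zero_apply, Matrix.cons_val_zero, Matrix.cons_val_one] at this
    linear_combination this
  · intro h
    ext v
    rw [key, koszul_one_form, h]
    simp

theorem dLinear_zero_apply (g : R) (X : L) :
    A.dLinear 0 (AlternatingMap.constOfIsEmpty R L (Fin 0) g) ![X] = A.act X g := by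
  change A.koszul _ _ = _
  simp [koszul, koszulBracketSum]

theorem dLinear_zero_mem_closedForms
    (hc : ∀ X Y g, A.act (A.bracket X Y) g = A.act X (A.act Y g) - A.act Y (A.act X g)) (g : R) :
    A.dLinear 0 (AlternatingMap.constOfIsEmpty R L (Fin 0) g) ∈ A.closedForms 1 := by
  rw [mem_closedForms_one]
  intro X Y
  simp only [dLinear_zero_apply, hc]

theorem cohomologyClass_add_exact {θ θ' : Form R L 1} (h : θ ∈ A.closedForms 1)
    (h' : θ' ∈ A.closedForms 1) {β : Form R L 0} (hβ : θ' = θ + A.dLinear 0 β) :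
    A.cohomologyClass θ' h' = A.cohomologyClass θ h := by
  refine Subtype.ext ?_
  change (A.exactForms 0).mkQ θ' = (A.exactForms 0).mkQ θ
  rw [hβ, map_add, Submodule.mkQ_apply, Submodule.mkQ_apply, add_eq_left,
    Submodule.Quotient.mk_eq_zero]
  exact ⟨β, rfl⟩

theorem nsmul_cohomologyClass {k : ℕ} {θ : Form R L (k + 1)} (h : θ ∈ A.closedForms (k + 1)) (r : ℕ) :
    r • A.cohomologyClass θ h = A.cohomologyClass (r • θ) (nsmul_mem h r) :=
  Subtype.ext (map_nsmul (A.exactForms k).mkQ r θ).symm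

/-- The operator on top degree forms which defines the modular tensor field of `P`. -/
noncomputable def modularOperator {n r : ℕ} (P : ⋀[R]^(n + 1) L) (α : Form R L n)
    (μ : Form R L r) : Form R L r :=
  A.lieForm (sharp P α) μ + (-1 : R) ^ (n + 1) • pairing (A.d α) P • μ

theorem isModularTensor_iff {n r : ℕ} (P : ⋀[R]^(n + 1) L) (μ : Form R L r) (N : ⋀[R]^n L) :
    A.IsModularTensor P μ N ↔ ∀ α, A.modularOperator P α μ = tensorCochain N ![α] • μ :=
  forall_congr' fun _ => eq_comm

/-! ### The Nambu algebroid and its two line bundle operators in a frame -/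

section Frame

variable {n : ℕ} (e : Module.Basis (Fin (n + 1)) R L) (f : R)

/-- A top wedge of frame vectors is multiplied by the trace, here of `W ↦ f[Z,W] + Z(f) W - W(f) Z`
read off on the frame. The three terms contribute `-f div Z`, `(n+1) Z(f)` and `-Z(f)`; the last by
`sum_act_repr`. -/
theorem lieMulti_frame (B : SkewAlgebroid R (Form R L n))
    (hB : ∀ α β, B.bracket α β =
      A.nambuBracket (f • exteriorPower.ιMulti R (n + 1) e) α β) (Z : L) :
    B.lieMulti (n + 1) (contractEquiv e Z)
        (exteriorPower.ιMulti R (n + 1) (e.map (contractEquiv e))) =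
      (n * A.act Z f - f * A.divergence e Z) •
        exteriorPower.ιMulti R (n + 1) (e.map (contractEquiv e)) := by
  rw [lieMulti_ιMulti]
  have h : ∀ j, (e.map (contractEquiv e)).repr (B.bracket (contractEquiv e Z)
      (e.map (contractEquiv e) j)) j =
      f * e.repr (A.bracket Z (e j)) j + A.act Z f - A.act (e j) f * e.repr Z j := by
    intro j
    rw [Module.Basis.map_apply, hB, nambuBracket_contractEquiv, Module.Basis.map_repr,
      LinearEquiv.trans_apply, LinearEquiv.symm_apply_apply, scaledBracket]
    simp
  simp only [map_update_basis, h]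
  rw [← Finset.sum_smul, Finset.sum_sub_distrib, Finset.sum_add_distrib, ← Finset.mul_sum,
    sum_act_repr, divergence_eq, Finset.sum_const, Finset.card_univ, Fintype.card_fin]
  congr 1
  rw [nsmul_eq_mul]
  push_cast
  ring

theorem nambuBracket_add (α β γ : Form R L n) :
    A.nambuBracket (f • exteriorPower.ιMulti R (n + 1) e) α (β + γ) =
      A.nambuBracket (f • exteriorPower.ιMulti R (n + 1) e) α β +
        A.nambuBracket (f • exteriorPower.ιMulti R (n + 1) e) α γ := by
  obtain ⟨X, rfl⟩ := (contractEquiv e).surjective α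
  obtain ⟨Y, rfl⟩ := (contractEquiv e).surjective β
  obtain ⟨Z, rfl⟩ := (contractEquiv e).surjective γ
  rw [← map_add]
  simp only [nambuBracket_contractEquiv]
  rw [← map_add, scaledBracket_add]

theorem nambuBracket_swap (α β : Form R L n) :
    A.nambuBracket (f • exteriorPower.ιMulti R (n + 1) e) α β =
      -A.nambuBracket (f • exteriorPower.ιMulti R (n + 1) e) β α := by
  obtain ⟨X, rfl⟩ := (contractEquiv e).surjective α
  obtain ⟨Y, rfl⟩ := (contractEquiv e).surjective β
  simp only [nambuBracket_contractEquiv]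
  rw [← map_neg, ← scaledBracket_swap]

theorem nambuBracket_jacobi
    (hJ : ∀ X Y Z, A.bracket X (A.bracket Y Z) =
      A.bracket (A.bracket X Y) Z + A.bracket Y (A.bracket X Z)) (α β γ : Form R L n) :
    A.nambuBracket (f • exteriorPower.ιMulti R (n + 1) e) α
        (A.nambuBracket (f • exteriorPower.ιMulti R (n + 1) e) β γ) =
      A.nambuBracket (f • exteriorPower.ιMulti R (n + 1) e)
        (A.nambuBracket (f • exteriorPower.ιMulti R (n + 1) e) α β) γ +
      A.nambuBracket (f • exteriorPower.ιMulti R (n + 1) e) β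
        (A.nambuBracket (f • exteriorPower.ιMulti R (n + 1) e) α γ) := by
  obtain ⟨X, rfl⟩ := (contractEquiv e).surjective α
  obtain ⟨Y, rfl⟩ := (contractEquiv e).surjective β
  obtain ⟨Z, rfl⟩ := (contractEquiv e).surjective γ
  simp only [nambuBracket_contractEquiv]
  rw [← map_add, scaledBracket_jacobi _ _ hJ (A.act_bracket_of_jacobi e hJ)]

theorem nambuBracket_smul (α : Form R L n) (g : R) (β : Form R L n) :
    A.nambuBracket (f • exteriorPower.ιMulti R (n + 1) e) α (g • β) =
      g • A.nambuBracket (f • exteriorPower.ιMulti R (n + 1) e) α β +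
        A.act (sharp (f • exteriorPower.ιMulti R (n + 1) e) α) g • β := by
  obtain ⟨X, rfl⟩ := (contractEquiv e).surjective α
  obtain ⟨Y, rfl⟩ := (contractEquiv e).surjective β
  rw [sharp_smul_top_contractEquiv, ← (contractEquiv e).map_smul, nambuBracket_contractEquiv,
    nambuBracket_contractEquiv, scaledBracket_smul, map_add, map_smul, map_smul, map_smul]
  rfl

theorem sharp_nambuBracket (α β : Form R L n) :
    sharp (f • exteriorPower.ιMulti R (n + 1) e)
        (A.nambuBracket (f • exteriorPower.ιMulti R (n + 1) e) α β) =
      A.bracket (sharp (f • exteriorPower.ιMulti R (n + 1) e) α)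
        (sharp (f • exteriorPower.ιMulti R (n + 1) e) β) := by
  obtain ⟨X, rfl⟩ := (contractEquiv e).surjective α
  obtain ⟨Y, rfl⟩ := (contractEquiv e).surjective β
  rw [nambuBracket_contractEquiv, sharp_smul_top_contractEquiv,
    sharp_smul_top_contractEquiv, sharp_smul_top_contractEquiv, smul_scaledBracket]

theorem modularOperator_topFormEquiv (P : ⋀[R]^(n + 1) L) (α : Form R L n) (g : R) :
    A.modularOperator P α (topFormEquiv e g) =
      g • A.modularOperator P α (topFormEquiv e 1) +
        A.act (sharp P α) g • topFormEquiv e 1 := by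
  simp only [modularOperator, topFormEquiv_apply, lieForm_smul, one_smul]
  module

theorem modularOperator_topFormEquiv_one (Z : L) :
    A.modularOperator (f • exteriorPower.ιMulti R (n + 1) e) (contractEquiv e Z)
        (topFormEquiv e 1) = A.act Z f • topFormEquiv e 1 := by
  rw [topFormEquiv_apply, one_smul, modularOperator, lieForm_add_pairing_det]

theorem tensorLie_canonicalLineEquiv (B : SkewAlgebroid R (Form R L n)) (α : Form R L n) (X : L)
    (h : B.act α = A.act X) (g : R) :
    B.tensorLie A (n + 1) (n + 1) α X h (canonicalLineEquiv e g) =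
      g • B.tensorLie A (n + 1) (n + 1) α X h (canonicalLineEquiv e 1) +
        B.act α g • canonicalLineEquiv e 1 := by
  rw [canonicalLineEquiv_apply, canonicalLineEquiv_apply, one_smul, tensorLie_tmul, tensorLie_tmul,
    lieForm_smul, TensorProduct.tmul_add, smul_add, TensorProduct.tmul_smul,
    TensorProduct.tmul_smul, TensorProduct.tmul_smul, add_assoc, h]

/-- The factor `n Z(f) - f div Z` from `⋀^(n+1) A` and the factor `f div Z + Z(f)` from the volume
form add up to `(n+1) Z(f)`. The anchor enters as a variable `X` with `X = f • Z` because the type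
of `h` depends on it. -/
theorem tensorLie_canonicalLineEquiv_one (B : SkewAlgebroid R (Form R L n))
    (hB : ∀ α β, B.bracket α β =
      A.nambuBracket (f • exteriorPower.ιMulti R (n + 1) e) α β) (Z : L)
    (X : L) (hX : X = f • Z) (h : B.act (contractEquiv e Z) = A.act X) :
    B.tensorLie A (n + 1) (n + 1) (contractEquiv e Z) X h (canonicalLineEquiv e 1) =
      (((n + 1 : ℕ) : R) * A.act Z f) • canonicalLineEquiv e 1 := by
  subst hX
  rw [canonicalLineEquiv_apply, one_smul, tensorLie_tmul, lieForm_det, lieMulti_frame A e f B hB,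
    divergence_smul, TensorProduct.tmul_smul, ← TensorProduct.smul_tmul', ← add_smul]
  congr 1
  push_cast
  ring

end Frame

end SkewAlgebroid

/-! ### Characteristic classes of trivial line bundles -/

section Line

variable {m : ℕ} {M : Type*} [TopologicalSpace M] [ChartedSpace (EuclideanSpace ℝ (Fin m)) M]

/-- A linear isomorphism carries `𝔪ₓ` onto `𝔪ₓ Q`, so the fibre condition becomes `g ∉ 𝔪ₓ`. -/
theorem nowhereVanishing_iff {Q : Type*} [AddCommGroup Q] [Module (SmoothFun m M) Q]
    (ψ : SmoothFun m M ≃ₗ[SmoothFun m M] Q) (g : SmoothFun m M) :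
    NowhereVanishing m M (ψ g) ↔ ∀ x, g x ≠ 0 := by
  refine forall_congr' fun x => not_congr ?_
  have h := Submodule.map_smul'' (RingHom.ker (ContMDiffMap.evalRingHom (I := 𝓡 m) (n := ∞)
    (R := ℝ) (I' := 𝓘(ℝ, ℝ)) x)) (⊤ : Submodule (SmoothFun m M) (SmoothFun m M))
    (ψ : SmoothFun m M →ₗ[SmoothFun m M] Q)
  rw [Submodule.map_top, LinearMap.range_eq_top.mpr ψ.surjective, Ideal.smul_eq_mul,
    Ideal.mul_top] at h
  rw [← h]
  change ψ g ∈ Submodule.map ψ.toLinearMap _ ↔ _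
  rw [Submodule.mem_map_equiv, LinearEquiv.symm_apply_apply, RingHom.mem_ker]
  rfl

variable [IsManifold (𝓡 m) ∞ M]

/-- The function `log |g|`, for a nowhere vanishing function `g`. -/
noncomputable def logAbs (g : SmoothFun m M) (hg : ∀ x, g x ≠ 0) : SmoothFun m M :=
  -- `Real.log` is `log |·|` away from zero, so negative values of `g` need no separate case.
  ⟨fun x => Real.log (g x), fun x =>
    (Real.contDiffAt_log.mpr (hg x)).contMDiffAt.comp x (g.contMDiff x)⟩

theorem mul_apply_logAbs (X : VField m M) (g : SmoothFun m M) (hg : ∀ x, g x ≠ 0) :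
    g * X.apply (logAbs g hg) = X.apply g := by
  ext x
  change g x * X.apply (logAbs g hg) x = X.apply g x
  rw [VField.apply_apply, VField.apply_apply]
  have h1 : MDifferentiableAt 𝓘(ℝ, ℝ) 𝓘(ℝ, ℝ) Real.log (g x) :=
    (Real.differentiableAt_log (hg x)).mdifferentiableAt
  have h2 := mvfderiv_comp_apply x h1 (g.contMDiff.mdifferentiableAt (x := x) (by simp)) (X x)
  have h3 : mvfderiv (𝓡 m) (logAbs g hg) x (X x) =
      (g x)⁻¹ * mvfderiv (𝓡 m) g x (X x) := by
    refine h2.trans ?_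
    have h4 : mvfderiv 𝓘(ℝ, ℝ) Real.log (g x) = fderiv ℝ Real.log (g x) :=
      mfderiv_eq_fderiv
    rw [h4, (Real.hasDerivAt_log (hg x)).hasFDerivAt.fderiv]
    exact mul_comm _ _
  rw [h3, mul_inv_cancel_left₀ (hg x)]

namespace LieAlgebroid

variable {L : Type*} [AddCommGroup L] [Module (SmoothFun m M) L] (A : LieAlgebroid m M L)

/-- The common core of both classes: a first-order operator on a trivial line bundle, with its
cocycle computed on one generator `ψ 1`, has exactly one characteristic class. Flatness of `D` is
not used, since closedness of `θ` is supplied. -/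
theorem isCharacteristicClass_iff {Q : Type*} [AddCommGroup Q] [Module (SmoothFun m M) Q]
    (hc : ∀ X Y g, A.toSkew.act (A.toSkew.bracket X Y) g =
      A.toSkew.act X (A.toSkew.act Y g) - A.toSkew.act Y (A.toSkew.act X g))
    (D : L → Q → Q) (ψ : SmoothFun m M ≃ₗ[SmoothFun m M] Q)
    (hD : ∀ a g, D a (ψ g) = g • D a (ψ 1) + A.toSkew.act a g • ψ 1)
    {θ : Form (SmoothFun m M) L 1} (hθ : θ ∈ A.toSkew.closedForms 1)
    (hDθ : ∀ a, D a (ψ 1) = θ ![a] • ψ 1) (c : A.H1) :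
    A.IsCharacteristicClass D c ↔ c = A.toSkew.cohomologyClass θ hθ := by
  have h1 : NowhereVanishing m M (ψ 1) :=
    (nowhereVanishing_iff ψ 1).mpr fun x => by
      change (1 : ℝ) ≠ 0
      exact one_ne_zero
  constructor
  · rintro ⟨-, h⟩
    obtain ⟨θ', hθ', hDθ', rfl⟩ := h _ h1
    have : θ' = θ := form_one_ext fun a => by
      have h2 := (hDθ' a).symm.trans (hDθ a)
      rw [← map_smul, ← map_smul] at h2
      simpa using ψ.injective h2
    subst this
    rfl
  · rintro rfl
    refine ⟨⟨_, h1⟩, fun s hs => ?_⟩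
    obtain ⟨g, rfl⟩ := ψ.surjective s
    have hg := (nowhereVanishing_iff ψ g).mp hs
    -- For the section `g • ψ 1` the Leibniz rule adds `a(g) = g · a(log |g|)`, so the cocycle
    -- changes by the coboundary of `log |g|`.
    refine ⟨θ + A.toSkew.dLinear 0 (AlternatingMap.constOfIsEmpty _ L (Fin 0) (logAbs g hg)),
      add_mem hθ (A.toSkew.dLinear_zero_mem_closedForms hc _), fun a => ?_,
      A.toSkew.cohomologyClass_add_exact _ _ rfl⟩
    rw [AlternatingMap.add_apply, SkewAlgebroid.dLinear_zero_apply, hD, hDθ]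
    have h3 : A.toSkew.act a g = g * A.toSkew.act a (logAbs g hg) :=
      (mul_apply_logAbs (A.anchor a) g hg).symm
    have h4 : ψ g = g • ψ 1 := by rw [← map_smul, smul_eq_mul, mul_one]
    rw [h3, h4]
    module

end LieAlgebroid

end Line

/-! ### A global smooth frame is a basis of the module of vector fields -/

section Frame

theorem contMDiffAt_det_apply {n : ℕ} {M : Type*} [TopologicalSpace M]
    [ChartedSpace (EuclideanSpace ℝ (Fin (n + 1))) M] {E : Type*} [NormedAddCommGroup E] [NormedSpace ℝ E]
    [FiniteDimensional ℝ E] {k : ℕ} (b : Module.Basis (Fin k) ℝ E) {w : Fin k → M → E} {x : M}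
    (hw : ∀ j, ContMDiffAt (𝓡 (n + 1)) 𝓘(ℝ, E) ∞ (w j) x) :
    ContMDiffAt (𝓡 (n + 1)) 𝓘(ℝ, ℝ) ∞ (fun y => b.det fun j => w j y) x := by
  have h : ∀ y, b.det (fun j => w j y) = ∑ σ : Equiv.Perm (Fin k),
      ((Equiv.Perm.sign σ : ℤ) : ℝ) * ∏ i, b.repr (w i y) (σ i) := by
    intro y
    rw [Module.Basis.det_apply, Matrix.det_apply']
    rfl
  simp only [h]
  refine ContMDiffAt.sum fun σ _ => contMDiffAt_const.mul (contMDiffAt_finsetProd fun i _ => ?_)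
  have hl : ContDiffAt ℝ ∞ (fun v : E => b.repr v (σ i)) (w i x) :=
    (LinearMap.toContinuousLinearMap (b.coord (σ i))).contDiff.contDiffAt
  exact hl.contMDiffAt.comp x (hw i)

variable {n : ℕ} {M : Type*} [TopologicalSpace M]
  [ChartedSpace (EuclideanSpace ℝ (Fin (n + 1))) M] [IsManifold (𝓡 (n + 1)) ∞ M]

/-- In a local trivialization Cramer's rule writes each coefficient as a quotient of determinants of
smooth vector-valued functions, with nonvanishing denominator. -/
theorem contMDiff_frame_coeff {s : Fin (n + 1) → (x : M) → TangentSpace (𝓡 (n + 1)) x}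
    (hs : IsLocalFrameOn (𝓡 (n + 1)) (EuclideanSpace ℝ (Fin (n + 1))) ∞ s Set.univ)
    (X : VField (n + 1) M) (i : Fin (n + 1)) :
    ContMDiff (𝓡 (n + 1)) 𝓘(ℝ, ℝ) ∞ fun x => (hs.toBasisAt (Set.mem_univ x)).repr (X x) i := by
  intro x
  let T := trivializationAt (EuclideanSpace ℝ (Fin (n + 1)))
    (TangentSpace (𝓡 (n + 1)) : M → Type _) x
  have hx : x ∈ T.baseSet := FiberBundle.mem_baseSet_trivializationAt' x
  let b := (EuclideanSpace.basisFun (Fin (n + 1)) ℝ).toBasis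
  let w : Fin (n + 1) → M → EuclideanSpace ℝ (Fin (n + 1)) := fun j y => (T ⟨y, s j y⟩).2
  let z : M → EuclideanSpace ℝ (Fin (n + 1)) := fun y => (T ⟨y, X y⟩).2
  have hw : ∀ j, ContMDiffAt (𝓡 (n + 1)) 𝓘(ℝ, EuclideanSpace ℝ (Fin (n + 1))) ∞ (w j) x :=
    fun j => (T.contMDiffAt_section_iff hx).mp (hs.contMDiffAt isOpen_univ (Set.mem_univ x) j)
  have hz : ContMDiffAt (𝓡 (n + 1)) 𝓘(ℝ, EuclideanSpace ℝ (Fin (n + 1))) ∞ z x :=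
    (T.contMDiffAt_section_iff hx).mp X.contMDiff.contMDiffAt
  let B : (y : M) → y ∈ T.baseSet →
      Module.Basis (Fin (n + 1)) ℝ (EuclideanSpace ℝ (Fin (n + 1))) := fun y hy =>
    (hs.toBasisAt (Set.mem_univ y)).map (T.linearEquivAt ℝ y hy)
  have hB : ∀ y hy, ⇑(B y hy) = fun j => w j y := by
    intro y hy
    funext j
    change T.linearEquivAt ℝ y hy (hs.toBasisAt (Set.mem_univ y) j) = _
    rw [hs.toBasisAt_coe]
    rfl
  have hdet : ∀ y ∈ T.baseSet, b.det (fun j => w j y) ≠ 0 := fun y hy => by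
    rw [← hB y hy]
    exact (b.isUnit_det (B y hy)).ne_zero
  have hc : ∀ y ∈ T.baseSet, (hs.toBasisAt (Set.mem_univ y)).repr (X y) i =
      b.det (fun j => Function.update w i z j y) / b.det (fun j => w j y) := by
    intro y hy
    rw [eq_div_iff (hdet y hy)]
    have h1 := map_update_basis (B y hy) b.det i (z y)
    have h2 : (B y hy).repr (z y) i = (hs.toBasisAt (Set.mem_univ y)).repr (X y) i := by
      have : z y = T.linearEquivAt ℝ y hy (X y) := rfl
      rw [this, Module.Basis.map_repr, LinearEquiv.trans_apply, LinearEquiv.symm_apply_apply]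
    rw [h2, hB, smul_eq_mul] at h1
    rw [← h1]
    congr 1
    funext j
    rcases eq_or_ne j i with rfl | hj
    · simp
    · simp [Function.update_of_ne hj]
  have hsm : ContMDiffAt (𝓡 (n + 1)) 𝓘(ℝ, ℝ) ∞ (fun y =>
      b.det (fun j => Function.update w i z j y) / b.det (fun j => w j y)) x := by
    refine ContMDiffAt.div₀ (contMDiffAt_det_apply b fun j => ?_)
      (contMDiffAt_det_apply b hw) (hdet x hx)
    rcases eq_or_ne j i with rfl | hj
    · simpa using hz
    · simpa [Function.update_of_ne hj] using hw j
  exact hsm.congr_of_eventuallyEq ((T.open_baseSet.mem_nhds hx : _ ∈ _) |>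
    Filter.mem_of_superset <| hc)

theorem Parallelizable.nonempty_basis (hM : Parallelizable (n + 1) M) :
    Nonempty (Module.Basis (Fin (n + 1)) (SmoothFun (n + 1) M) (VField (n + 1) M)) := by
  obtain ⟨s, hs⟩ := hM
  let S : Fin (n + 1) → VField (n + 1) M := fun i =>
    ⟨s i, contMDiffOn_univ.mp (hs.contMDiffOn i)⟩
  have hsum : ∀ (c : Fin (n + 1) → SmoothFun (n + 1) M) (x : M),
      (∑ i, c i • S i) x = ∑ i, c i x • s i x := by
    intro c x
    have := map_sum (ContMDiffSection.coeAddHom (𝓡 (n + 1)) (EuclideanSpace ℝ (Fin (n + 1))) ∞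
      (TangentSpace (𝓡 (n + 1)) : M → Type _)) (fun i => c i • S i) Finset.univ
    have := congrFun this x
    rw [Finset.sum_apply] at this
    exact this
  have hb : ∀ x i, hs.toBasisAt (Set.mem_univ x) i = s i x := fun x i => hs.toBasisAt_coe _ i
  refine ⟨Module.Basis.mk (v := S) ?_ ?_⟩
  · rw [Fintype.linearIndependent_iff]
    intro c hc i
    ext x
    have h := hsum c x
    rw [hc] at h
    exact Fintype.linearIndependent_iff.mp (hs.linearIndependent (Set.mem_univ x))
      (fun i => c i x) h.symm i
  · intro X _
    let c : Fin (n + 1) → SmoothFun (n + 1) M := fun i => ⟨_, contMDiff_frame_coeff hs X i⟩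
    have hX : X = ∑ i, c i • S i := by
      ext x
      rw [hsum]
      have := (hs.toBasisAt (Set.mem_univ x)).sum_repr (X x)
      simp only [hb] at this
      exact this.symm
    rw [hX]
    exact Submodule.sum_mem _ fun i _ => Submodule.smul_mem _ _ (Submodule.subset_span ⟨i, rfl⟩)

end Frame

/-! ### The two modular classes of `f e₀ ∧ ⋯ ∧ eₙ` -/

section Nambu

variable {n : ℕ} {M : Type*} [TopologicalSpace M]
  [ChartedSpace (EuclideanSpace ℝ (Fin (n + 1))) M] [IsManifold (𝓡 (n + 1)) ∞ M]
  (e : Module.Basis (Fin (n + 1)) (SmoothFun (n + 1) M) (VField (n + 1) M))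
  (f : SmoothFun (n + 1) M)

theorem tangent_act_bracket (e : Module.Basis (Fin (n + 1)) (SmoothFun (n + 1) M) (VField (n + 1) M))
    (X Y : VField (n + 1) M) (g : SmoothFun (n + 1) M) :
    (tangentAlgebroid (n + 1) M).toSkew.act ((tangentAlgebroid (n + 1) M).toSkew.bracket X Y) g =
      (tangentAlgebroid (n + 1) M).toSkew.act X ((tangentAlgebroid (n + 1) M).toSkew.act Y g) -
      (tangentAlgebroid (n + 1) M).toSkew.act Y ((tangentAlgebroid (n + 1) M).toSkew.act X g) :=
  (tangentAlgebroid (n + 1) M).toSkew.act_bracket_of_jacobi e (tangentAlgebroid (n + 1) M).jacobi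
    X Y g

/-- The Lie algebroid structure on `⋀ⁿ T^*M` defined by the `(n+1)`-vector field `f e₀ ∧ ⋯ ∧ eₙ`. -/
noncomputable def nambuAlgebroid : LieAlgebroid (n + 1) M
    (Form (SmoothFun (n + 1) M) (VField (n + 1) M) n) where
  bracket := (tangentAlgebroid (n + 1) M).toSkew.nambuBracket
    (f • exteriorPower.ιMulti (SmoothFun (n + 1) M) (n + 1) e)
  anchor := sharp (f • exteriorPower.ιMulti (SmoothFun (n + 1) M) (n + 1) e)
  bracket_add := SkewAlgebroid.nambuBracket_add _ e f
  bracket_swap := SkewAlgebroid.nambuBracket_swap _ e f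
  jacobi := SkewAlgebroid.nambuBracket_jacobi _ e f (tangentAlgebroid (n + 1) M).jacobi
  bracket_smul := SkewAlgebroid.nambuBracket_smul _ e f
  anchor_bracket := SkewAlgebroid.sharp_nambuBracket _ e f

theorem nambuAlgebroid_bracket (Z W : VField (n + 1) M) :
    (nambuAlgebroid e f).toSkew.bracket (contractEquiv e Z) (contractEquiv e W) =
      contractEquiv e ((tangentAlgebroid (n + 1) M).toSkew.scaledBracket f Z W) :=
  SkewAlgebroid.nambuBracket_contractEquiv _ e f Z W

theorem nambuAlgebroid_anchor (Z : VField (n + 1) M) :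
    (nambuAlgebroid e f).anchor (contractEquiv e Z) = f • Z :=
  sharp_smul_top_contractEquiv e f Z

theorem nambuAlgebroid_act (Z : VField (n + 1) M) (g : SmoothFun (n + 1) M) :
    (nambuAlgebroid e f).toSkew.act (contractEquiv e Z) g =
      f * (tangentAlgebroid (n + 1) M).toSkew.act Z g := by
  change (tangentAlgebroid (n + 1) M).toSkew.act ((nambuAlgebroid e f).anchor _) g = _
  rw [nambuAlgebroid_anchor, map_smul]
  rfl

theorem nambuAlgebroid_act_bracket (α β : Form (SmoothFun (n + 1) M) (VField (n + 1) M) n)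
    (g : SmoothFun (n + 1) M) :
    (nambuAlgebroid e f).toSkew.act ((nambuAlgebroid e f).toSkew.bracket α β) g =
      (nambuAlgebroid e f).toSkew.act α ((nambuAlgebroid e f).toSkew.act β g) -
      (nambuAlgebroid e f).toSkew.act β ((nambuAlgebroid e f).toSkew.act α g) :=
  (nambuAlgebroid e f).toSkew.act_bracket_of_jacobi (e.map (contractEquiv e))
    (nambuAlgebroid e f).jacobi α β g

/-- The modular cocycle of `f e₀ ∧ ⋯ ∧ eₙ` with respect to the volume form dual to the frame. -/
noncomputable def frameCocycle : Form (SmoothFun (n + 1) M)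
    (Form (SmoothFun (n + 1) M) (VField (n + 1) M) n) 1 :=
  AlternatingMap.ofSubsingleton _ _ _ (0 : Fin 1)
    { toFun := fun α => (tangentAlgebroid (n + 1) M).toSkew.act ((contractEquiv e).symm α) f
      map_add' := fun α β => by simp
      map_smul' := fun r α => by simp }

theorem frameCocycle_apply (Z : VField (n + 1) M) :
    frameCocycle e f ![contractEquiv e Z] = (tangentAlgebroid (n + 1) M).toSkew.act Z f := by
  change (tangentAlgebroid (n + 1) M).toSkew.act ((contractEquiv e).symm _) f = _
  simp

/-- Applied to `f`, the bracket `f[X,Y] + X(f) Y - Y(f) X` loses its last two terms, which cancel,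
leaving `f (X(Y(f)) - Y(X(f)))`; this is the cocycle condition for the anchor `fX`. -/
theorem frameCocycle_mem_closedForms :
    frameCocycle e f ∈ (nambuAlgebroid e f).toSkew.closedForms 1 := by
  rw [SkewAlgebroid.mem_closedForms_one]
  intro α β
  obtain ⟨X, rfl⟩ := (contractEquiv e).surjective α
  obtain ⟨Y, rfl⟩ := (contractEquiv e).surjective β
  rw [nambuAlgebroid_bracket, frameCocycle_apply, frameCocycle_apply, frameCocycle_apply,
    nambuAlgebroid_act, nambuAlgebroid_act, SkewAlgebroid.scaledBracket]
  simp only [map_add, map_sub, map_smul, Derivation.add_apply, Derivation.sub_apply,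
    Derivation.smul_apply, smul_eq_mul, tangent_act_bracket e]
  ring

theorem exists_eq_tensorCochain
    (e : Module.Basis (Fin (n + 1)) (SmoothFun (n + 1) M) (VField (n + 1) M))
    (θ : Form (SmoothFun (n + 1) M) (Form (SmoothFun (n + 1) M) (VField (n + 1) M) n) 1) :
    ∃ N : ⋀[SmoothFun (n + 1) M]^n (VField (n + 1) M), θ = tensorCochain N := by
  obtain ⟨N, hN⟩ := exists_pairing_eq e ((AlternatingMap.ofSubsingleton _ _ _ (0 : Fin 1)).symm θ)
  refine ⟨N, form_one_ext fun α => ?_⟩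
  rw [tensorCochain_apply, hN]
  change _ = θ fun _ => α
  congr 1
  ext i; fin_cases i; rfl

/-- Modular tensor fields and `1`-cochains correspond by `exists_eq_tensorCochain`, so the Nambu
class becomes a characteristic class for the operator that defines the modular tensor, and the
argument for line bundles applies. -/
theorem isNambuModularClass_iff_isCharacteristicClass
    (e : Module.Basis (Fin (n + 1)) (SmoothFun (n + 1) M) (VField (n + 1) M))
    (P : ⋀[SmoothFun (n + 1) M]^(n + 1) (VField (n + 1) M))
    (A : LieAlgebroid (n + 1) M (Form (SmoothFun (n + 1) M) (VField (n + 1) M) n)) (c : A.H1) :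
    IsNambuModularClass P A c ↔
      A.IsCharacteristicClass
        ((tangentAlgebroid (n + 1) M).toSkew.modularOperator (r := n + 1) P) c := by
  refine and_congr Iff.rfl (forall₂_congr fun μ _ => ⟨?_, ?_⟩)
  · rintro ⟨N, hN, h, hc⟩
    exact ⟨tensorCochain N, hN, (SkewAlgebroid.isModularTensor_iff _ P μ N).mp h, hc⟩
  · rintro ⟨θ, hθ, h, hc⟩
    obtain ⟨N, rfl⟩ := exists_eq_tensorCochain e θ
    exact ⟨N, hθ, (SkewAlgebroid.isModularTensor_iff _ P μ N).mpr h, hc⟩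

theorem isNambuModularClass_iff (c : (nambuAlgebroid e f).H1) :
    IsNambuModularClass (f • exteriorPower.ιMulti (SmoothFun (n + 1) M) (n + 1) e)
      (nambuAlgebroid e f) c ↔
    c = (nambuAlgebroid e f).toSkew.cohomologyClass _ (frameCocycle_mem_closedForms e f) := by
  rw [isNambuModularClass_iff_isCharacteristicClass e]
  refine (nambuAlgebroid e f).isCharacteristicClass_iff (nambuAlgebroid_act_bracket e f)
    _ (topFormEquiv e)
    (fun α g => ?_)
    (frameCocycle_mem_closedForms e f) (fun α => ?_) c
  · have h := (tangentAlgebroid (n + 1) M).toSkew.modularOperator_topFormEquiv e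
      (f • exteriorPower.ιMulti (SmoothFun (n + 1) M) (n + 1) e) α g
    rw [h]
    rfl
  · obtain ⟨Z, rfl⟩ := (contractEquiv e).surjective α
    have h := (tangentAlgebroid (n + 1) M).toSkew.modularOperator_topFormEquiv_one e f Z
    rw [frameCocycle_apply, h]

theorem LieAlgebroid.canonicalRep_apply {L : Type*} [AddCommGroup L]
    [Module (SmoothFun (n + 1) M) L] (A : LieAlgebroid (n + 1) M L) (r : ℕ) (a : L)
    (s : A.CanonicalLine r) :
    A.canonicalRep r a s = A.toSkew.tensorLie (tangentAlgebroid (n + 1) M).toSkew r (n + 1) a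
      (A.anchor a) rfl s := rfl

theorem nambuAlgebroid_canonicalRep (g : SmoothFun (n + 1) M)
    (α : Form (SmoothFun (n + 1) M) (VField (n + 1) M) n) :
    (nambuAlgebroid e f).canonicalRep (n + 1) α (canonicalLineEquiv e g) =
      g • (nambuAlgebroid e f).canonicalRep (n + 1) α (canonicalLineEquiv e 1) +
        (nambuAlgebroid e f).toSkew.act α g • canonicalLineEquiv e 1 :=
  SkewAlgebroid.tensorLie_canonicalLineEquiv _ e _ _ _ _ g

set_option maxHeartbeats 1000000 in
theorem nambuAlgebroid_canonicalRep_one (Z : VField (n + 1) M) :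
    (nambuAlgebroid e f).canonicalRep (n + 1) (contractEquiv e Z) (canonicalLineEquiv e 1) =
      ((n + 1) • frameCocycle e f) ![contractEquiv e Z] • canonicalLineEquiv e 1 := by
  have hB : ∀ α β, (nambuAlgebroid e f).toSkew.bracket α β =
      (tangentAlgebroid (n + 1) M).toSkew.nambuBracket
        (f • exteriorPower.ιMulti (SmoothFun (n + 1) M) (n + 1) e) α β := fun _ _ => rfl
  have h := (tangentAlgebroid (n + 1) M).toSkew.tensorLie_canonicalLineEquiv_one e f
    (nambuAlgebroid e f).toSkew hB Z
    ((nambuAlgebroid e f).anchor (contractEquiv e Z)) (nambuAlgebroid_anchor e f Z) rfl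
  have h2 : ((n + 1) • frameCocycle e f) ![contractEquiv e Z] = ((n + 1 : ℕ) : SmoothFun (n + 1) M) *
      (tangentAlgebroid (n + 1) M).toSkew.act Z f := by
    rw [← frameCocycle_apply, ← nsmul_eq_mul]
    rfl
  rw [h2, LieAlgebroid.canonicalRep_apply, h]

theorem isModularClass_iff (c : (nambuAlgebroid e f).H1) :
    (nambuAlgebroid e f).IsModularClass (n + 1) c ↔
    c = (n + 1) • (nambuAlgebroid e f).toSkew.cohomologyClass _
      (frameCocycle_mem_closedForms e f) := by
  rw [SkewAlgebroid.nsmul_cohomologyClass]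
  exact (nambuAlgebroid e f).isCharacteristicClass_iff (nambuAlgebroid_act_bracket e f) _
    (canonicalLineEquiv e) (fun α g => nambuAlgebroid_canonicalRep e f g α)
    (nsmul_mem (frameCocycle_mem_closedForms e f) _) 
    ((contractEquiv e).surjective.forall.mpr (nambuAlgebroid_canonicalRep_one e f)) c

end Nambu

end NambuModular

theorem theorem5p3 (n : ℕ) (M : Type*) [TopologicalSpace M] [T2Space M] [SecondCountableTopology M]
    [ChartedSpace (EuclideanSpace ℝ (Fin (n + 1))) M] [IsManifold (𝓡 (n + 1)) ∞ M]
    (hM : NambuModular.Parallelizable (n + 1) M)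
    (P : ⋀[NambuModular.SmoothFun (n + 1) M]^(n + 1) (NambuModular.VField (n + 1) M)) :
    ∃ A : NambuModular.LieAlgebroid (n + 1) M
        (NambuModular.Form (NambuModular.SmoothFun (n + 1) M) (NambuModular.VField (n + 1) M) n),
      NambuModular.IsNambuAlgebroid P A ∧
      (∃! c : A.H1, NambuModular.IsNambuModularClass P A c) ∧
      (∃! c' : A.H1, A.IsModularClass (n + 1) c') ∧
      ∀ c c' : A.H1, NambuModular.IsNambuModularClass P A c → A.IsModularClass (n + 1) c' →
        c' = (n + 1) • c := by
  obtain ⟨e⟩ := hM.nonempty_basis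
  -- Every top multivector field is a function times the frame wedge; no nonvanishing of `f` is
  -- imposed.
  obtain ⟨f, rfl⟩ := (NambuModular.topPowerEquiv e).surjective P
  rw [NambuModular.topPowerEquiv_apply]
  refine ⟨NambuModular.nambuAlgebroid e f, ⟨fun _ _ => rfl, rfl⟩, ?_, ?_, ?_⟩
  · simp only [NambuModular.isNambuModularClass_iff, existsUnique_eq]
  · simp only [NambuModular.isModularClass_iff, existsUnique_eq]
  · simp only [NambuModular.isNambuModularClass_iff, NambuModular.isModularClass_iff]
    rintro c c' rfl rfl
    rfl
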